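/- Let $d\ge 2$, and equip $\mathbb{R}^{n_1\times\dots\times n_d}$ with the Frobenius inner product and norm $\|\cdot\|_F$; $\|\cdot\|$ denotes the induced operator norm. For a tensor $X$ let $X^{\langle k\rangle}$ be its $k$-th unfolding, a matrix of size $(n_1\cdots n_k)\times(n_{k+1}\cdots n_d)$, let $\operatorname{rank}_{TT}(X)=(\operatorname{rank}X^{\langle 1\rangle},\dots,\operatorname{rank}X^{\langle d-1\rangle})$, and for $r=(r_1,\dots,r_{d-1})$ let $\mathcal M_r=\{X:\operatorname{rank}_{TT}(X)=r\}$. This is a smooth embedded submanifold; $\mathcal P_X$ denotes the orthogonal projection onto its tangent space $T_X\mathcal M_r$. Write $\sigma_{\min}(X)=\bigl(\sum_{k=1}^{d-1}1/\sigma_{\min}(X^{\langle k\rangle})\bigr)^{-1}$, where $\sigma_{\min}$ of a matrix is its smallest positive singular value. Let $\Omega$ be a finite collection of multi-indices from $[n_1]\times\dots\times[n_d]$, repetitions allowed, let $\rho=|\Omega|/(n_1\cdots n_d)$, and let $\mathcal R_\Omega X=\sum_{\omega\in\Omega}X(\omega)E_\omega$, where $E_\omega$ is the canonical basis tensor. Let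 $\mathrm{TT\text{-}SVD}_r(Z)$ be a result of the truncated TT-SVD algorithm, which for $k=1,\dots,d-1$ in turn replaces the $k$-th unfolding of the current tensor by a truncated singular value decomposition of rank $r_k$, starting from $Z$. Let $A\in\mathcal M_r$ and suppose that, for real numbers $\varepsilon$ and $C$, $$\|\mathcal P_A-\rho^{-1}\mathcal P_A\mathcal R_\Omega\mathcal P_A\|<\varepsilon,\qquad \|\mathcal R_\Omega\|\le C .$$ Let $(X_t)_{t\ge 0}$ be a sequence of iterates of Riemannian gradient descent, $$X_{t+1}=\mathrm{TT\text{-}SVD}_r(X_t-\alpha_tY_t),\qquad Y_t=\mathcal P_{X_t}(\mathcal R_\Omega X_t-\mathcal R_\Omega A),\qquad \alpha_t=\frac{\|Y_t\|_F^2}{\langle\mathcal R_\Omega Y_t,Y_t\rangle_F}$$ (with $\alpha_t=0$ if the denominator vanishes). Put $$\varepsilon_t=\varepsilon+\frac{2\|X_t-A\|_F}{\sigma_{\min}(A)}\,(1+2C\rho^{-1}),\qquad \beta_t=(1+\sqrt{d-1})\left[\frac{2\varepsilon_t}{1-\varepsilon_t}+\Bigl(1+\frac{C}{1-\varepsilon_t}\Bigr)\frac{\|X_t-A\|_F}{\sigma_{\min}(A)}\right].$$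 1. For every $t$ with $X_t\in\mathcal M_r$ and $\varepsilon_t<1$, $$\|X_{t+1}-A\|_F\le\beta_t\,\|X_t-A\|_F .$$ 2. If $\varepsilon<(3+2\sqrt{d-1})^{-1}$, $X_0\in\mathcal M_r$ and $$\frac{\|X_0-A\|_F}{\sigma_{\min}(A)}<\left(5+C+8C\rho^{-1}+\frac{2+4C\rho^{-1}}{1+\sqrt{d-1}}-\varepsilon\right)^{-1}\left(\frac{1-\varepsilon}{1+\sqrt{d-1}}-2\varepsilon\right),$$ then $\beta_0<1$ and, for all $t\ge 0$, $$\|X_{t+1}-A\|_F\le\beta_0^{\,t+1}\,\|X_0-A\|_F ,$$ with strict inequality if $X_0\ne A$. -/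

import Mathlib

open Filter Topology

noncomputable section

namespace TTCompletion

variable {d : ℕ} {n : Fin d → ℕ}

/-- Multi-indices `(i₁, …, i_d)` in `[n₁] × … × [n_d]`. -/
abbrev MultiIndex (n : Fin d → ℕ) : Type := (j : Fin d) → Fin (n j)

/-- Real tensors of size `n₁ × … × n_d`, with the Frobenius inner product and norm. -/
abbrev Tensor (n : Fin d → ℕ) : Type := EuclideanSpace ℝ (MultiIndex n)

/-- The first `k` indices `(i₁, …, i_k)`: the rows of the `k`-th unfolding. -/
abbrev RowIndex (n : Fin d → ℕ) (k : ℕ) : Type := (j : {j : Fin d // j.val < k}) → Fin (n j)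

/-- The last `d - k` indices `(i_{k+1}, …, i_d)`: the columns of the `k`-th unfolding. -/
abbrev ColIndex (n : Fin d → ℕ) (k : ℕ) : Type := (j : {j : Fin d // ¬ j.val < k}) → Fin (n j)

/-- The `k`-th unfolding `X^{⟨k⟩}`, a matrix of size `(n₁ ⋯ n_k) × (n_{k+1} ⋯ n_d)`. -/
def unfolding (k : ℕ) (X : Tensor n) : Matrix (RowIndex n k) (ColIndex n k) ℝ :=
  Matrix.of fun a b =>
    X ((Equiv.piEquivPiSubtypeProd (fun j : Fin d => j.val < k) (fun j => Fin (n j))).symm (a, b))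

/-- The TT-rank `(rank X^{⟨1⟩}, …, rank X^{⟨d-1⟩})`; the entry with number `k : Fin (d - 1)`
belongs to the unfolding number `k + 1`. -/
def ttRank (X : Tensor n) : Fin (d - 1) → ℕ := fun k => (unfolding (k.val + 1) X).rank

/-- The set `𝓜_r` of tensors of TT-rank `r`. -/
def fixedRank (n : Fin d → ℕ) (r : Fin (d - 1) → ℕ) : Set (Tensor n) := {X | ttRank X = r}

/-- The smallest positive singular value of a matrix. -/
def sigmaMinMatrix {m l : Type*} [Fintype m] [Fintype l] [DecidableEq l] (M : Matrix m l ℝ) : ℝ :=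
  sInf {s : ℝ | 0 < s ∧ ∃ i : ℕ, s = (Matrix.toEuclideanLin M).singularValues i}

/-- `σ_min(X) = (∑ₖ 1 / σ_min(X^{⟨k⟩}))⁻¹`, the sum over `k = 1, …, d - 1`. -/
def sigmaMin (X : Tensor n) : ℝ :=
  (∑ k : Fin (d - 1), 1 / sigmaMinMatrix (unfolding (k.val + 1) X))⁻¹

/-- The tangent space at `X` of a submanifold `M` of a normed space: the velocities at `X` of the
smooth curves in `M` through `X`. (For an embedded submanifold these velocities already form a
linear subspace, so that taking the span changes nothing.) -/
def tangentSpaceAt {V : Type*} [NormedAddCommGroup V] [NormedSpace ℝ V] (M : Set V) (X : V) :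
    Submodule ℝ V :=
  Submodule.span ℝ {v : V | ∃ γ : ℝ → V,
    ContDiffAt ℝ ((⊤ : ℕ∞) : WithTop ℕ∞) γ 0 ∧ γ 0 = X ∧ (∀ᶠ s in 𝓝 (0 : ℝ), γ s ∈ M) ∧ HasDerivAt γ v 0}

/-- The orthogonal projection onto the tangent space `T_X 𝓜_r`. -/
def tangentProj (r : Fin (d - 1) → ℕ) (X : Tensor n) : Tensor n →L[ℝ] Tensor n :=
  (tangentSpaceAt (fixedRank n r) X).starProjection

/-- The sampling operator `𝓡_Ω X = ∑_{ω ∈ Ω} X(ω) E_ω`; the collection `Ω` may contain repeated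
multi-indices. -/
def samplingOp (Ω : Multiset (MultiIndex n)) : Tensor n →L[ℝ] Tensor n :=
  (Ω.map fun ω => (EuclideanSpace.proj ω : Tensor n →L[ℝ] ℝ).smulRight
    (EuclideanSpace.single ω (1 : ℝ) : Tensor n)).sum

/-- The density `ρ = |Ω| / (n₁ ⋯ n_d)` of known elements. -/
def density (Ω : Multiset (MultiIndex n)) : ℝ := (Multiset.card Ω : ℝ) / ∏ j : Fin d, (n j : ℝ)

/-- `N` is a truncation of `M` to rank (at most) `r` by means of a singular value decomposition
`M = ∑ᵢ σᵢ uᵢ vᵢᵀ`, `σ₀ ≥ σ₁ ≥ … ≥ 0`: only the `r` leading terms are kept. (The decomposition, and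
hence `N`, need not be unique.) -/
def IsTruncatedSVD {m l : Type*} [Fintype m] [Fintype l] (r : ℕ) (M N : Matrix m l ℝ) : Prop :=
  ∃ (q : ℕ) (σ : Fin q → ℝ) (u : Fin q → EuclideanSpace ℝ m) (v : Fin q → EuclideanSpace ℝ l),
    Antitone σ ∧ (∀ i, 0 ≤ σ i) ∧ Orthonormal ℝ u ∧ Orthonormal ℝ v ∧
    M = ∑ i : Fin q, σ i • Matrix.vecMulVec (u i) (v i) ∧
    N = ∑ i : Fin q with i.val < r, σ i • Matrix.vecMulVec (u i) (v i)

/-- `W` is a result `TT-SVD_r(Z)` of the truncated TT-SVD algorithm: for `k = 1, …, d - 1` in turn,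
the `k`-th unfolding of the current tensor is replaced by its truncated SVD of rank `r_k`. (The
usual implementation computes the same truncations in the coordinates given by the left-orthogonal
TT-cores `U₁, …, U_{k-1}` found before.) -/
def IsTTSVD (r : Fin (d - 1) → ℕ) (Z W : Tensor n) : Prop :=
  ∃ Y : ℕ → Tensor n, Y 0 = Z ∧ Y (d - 1) = W ∧
    ∀ k : Fin (d - 1), IsTruncatedSVD (r k)
      (unfolding (k.val + 1) (Y k.val)) (unfolding (k.val + 1) (Y (k.val + 1)))

/-- The Riemannian gradient `Y = 𝓟_X (𝓡_Ω X - 𝓡_Ω A)`. -/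
def riemGrad (r : Fin (d - 1) → ℕ) (Ω : Multiset (MultiIndex n)) (A X : Tensor n) : Tensor n :=
  tangentProj r X (samplingOp Ω X - samplingOp Ω A)

/-- The exact line-search step size `α = ‖Y‖² / ⟨𝓡_Ω Y, Y⟩`. -/
def stepSize (Ω : Multiset (MultiIndex n)) (Y : Tensor n) : ℝ :=
  ‖Y‖ ^ 2 / inner ℝ (samplingOp Ω Y) Y

/-- One step `X' = TT-SVD_r(X - α Y)` of Riemannian gradient descent for tensor completion. -/
def IsRGDStep (r : Fin (d - 1) → ℕ) (Ω : Multiset (MultiIndex n)) (A X X' : Tensor n) : Prop :=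
  IsTTSVD r (X - stepSize Ω (riemGrad r Ω A X) • riemGrad r Ω A X) X'

/-- `ε(X) = E(2 ‖X - A‖ / σ_min(A))` with `E(δ) = ε + δ (1 + 2 C ρ⁻¹)`. -/
def epsAt (Ω : Multiset (MultiIndex n)) (ε C : ℝ) (A X : Tensor n) : ℝ :=
  ε + (2 * ‖X - A‖ / sigmaMin A) * (1 + 2 * C * (density Ω)⁻¹)

/-- The contraction factor `β` of a step that starts at `X`. -/
def betaAt (Ω : Multiset (MultiIndex n)) (ε C : ℝ) (A X : Tensor n) : ℝ :=
  (1 + √((d : ℝ) - 1)) *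
    (2 * epsAt Ω ε C A X / (1 - epsAt Ω ε C A X) +
      (1 + C / (1 - epsAt Ω ε C A X)) * (‖X - A‖ / sigmaMin A))

end TTCompletion

end

set_option linter.unusedSectionVars false

noncomputable section

namespace TTCompletion

/-! ### Gaps between subspaces, singular values, and exact line search. -/

section Hilbert

variable {E F : Type*} [NormedAddCommGroup E] [InnerProductSpace ℝ E] [FiniteDimensional ℝ E]
  [NormedAddCommGroup F] [InnerProductSpace ℝ F] [FiniteDimensional ℝ F]

/-! Put D = X_t - A and δ = ‖D‖ / σ_min(A). TT-SVD is quasi-optimal with factor 1 + √(d-1)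
(`IsTTSVD.norm_sub_le`), so it suffices to bound D - αY with Y = P_X R_Ω D. Under restricted
isometry with constant e at X, line search contracts the tangential part of D by 2e/(1-e), while the
normal part of D has size at most δ‖D‖ by curvature (`norm_sub_lineSearch_le`,
`norm_sub_tangentProj_self_le`). Restricted isometry passes from A to X because ‖P_X - P_A‖ ≤ √2 δ
(`norm_tangentProj_sub_le`). The slack between √2 and the 2 in ε_t pays for having C in β_t where
line search gives Cρ⁻¹ (`contraction_lt`).

The geometry needs no parametrization of the manifold. A velocity at X is killed, for every
unfolding, by (I - column projection)(I - row projection). Conversely, the distance from any Y to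
the tangent space is at most the sum of the norms of these normal parts, by comparison with an
explicit tangent vector (`norm_sub_tangentProj_le`). Each normal part is then a matrix perturbation
estimate, and summing over unfoldings produces 1 / σ_min(A).

For the second claim, the starting condition gives β_0 < 1 and δ < 1. Since β increases with the
distance and a rank cannot drop within distance σ_min(A) of A, induction keeps the iterates on the
manifold. -/

lemma inner_starProjection_self (U : Submodule ℝ E) (v : E) :
    inner ℝ v (U.starProjection v) = ‖U.starProjection v‖ ^ 2 := by
  have h := U.starProjection_inner_eq_zero v _ (U.starProjection_apply_mem v)
  rw [inner_sub_left, real_inner_self_eq_norm_sq] at h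
  linarith

lemma norm_sub_starProjection_sq (U : Submodule ℝ E) (v : E) :
    ‖v - U.starProjection v‖ ^ 2 = ‖v‖ ^ 2 - ‖U.starProjection v‖ ^ 2 := by
  rw [norm_sub_sq_real, inner_starProjection_self]
  ring

lemma norm_sub_starProjection_le (U : Submodule ℝ E) (v : E) :
    ‖v - U.starProjection v‖ ≤ ‖v‖ := by
  refine le_of_sq_le_sq ?_ (norm_nonneg _)
  rw [norm_sub_starProjection_sq]
  nlinarith [sq_nonneg ‖U.starProjection v‖]

lemma norm_sub_starProjection_le_of_mem (U : Submodule ℝ E) (v : E) {u : E} (hu : u ∈ U) :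
    ‖v - U.starProjection v‖ ≤ ‖v - u‖ := by
  have h : v - U.starProjection v = (v - u) - U.starProjection (v - u) := by
    rw [map_sub, Submodule.starProjection_eq_self_iff.2 hu]
    abel
  rw [h]
  exact norm_sub_starProjection_le U _

lemma injective_starProjection_domRestrict {U V : Submodule ℝ E} {s : ℝ} (hs : s < 1)
    (h : ∀ u ∈ U, ‖u - V.starProjection u‖ ≤ s * ‖u‖) :
    Function.Injective (((V.starProjection : E →ₗ[ℝ] E).codRestrict V
      V.starProjection_apply_mem).domRestrict U) := by
  rw [injective_iff_map_eq_zero]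
  rintro ⟨u, hu⟩ h0
  have h1 : V.starProjection u = 0 := congrArg Subtype.val h0
  have h2 := h u hu
  rw [h1, sub_zero] at h2
  have : ‖u‖ = 0 := by nlinarith [norm_nonneg u]
  exact Subtype.ext (norm_eq_zero.1 this)

/-- If every vector of `U` is close to `V`, then `dim U ≤ dim V`. -/
lemma finrank_le_of_norm_sub_starProjection_le {U V : Submodule ℝ E} {s : ℝ} (hs : s < 1)
    (h : ∀ u ∈ U, ‖u - V.starProjection u‖ ≤ s * ‖u‖) :
    Module.finrank ℝ U ≤ Module.finrank ℝ V :=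
  LinearMap.finrank_le_finrank_of_injective (injective_starProjection_domRestrict hs h)

/-- For subspaces of equal dimension, the gap between them is symmetric. -/
lemma norm_sub_starProjection_le_symm {U V : Submodule ℝ E}
    (hd : Module.finrank ℝ U = Module.finrank ℝ V) {s : ℝ} (hs : 0 ≤ s)
    (h : ∀ u ∈ U, ‖u - V.starProjection u‖ ≤ s * ‖u‖) (v : E) (hv : v ∈ V) :
    ‖v - U.starProjection v‖ ≤ s * ‖v‖ := by
  rcases le_or_gt 1 s with h1 | h1
  · exact (norm_sub_starProjection_le U v).trans (le_mul_of_one_le_left (norm_nonneg v) h1)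
  have hinj := injective_starProjection_domRestrict h1 h
  -- Equal dimensions make the injective projection U → V surjective, so v = P_V u. What remains is
  -- the symmetry of the angle between u and v.
  obtain ⟨⟨u, hu⟩, hu'⟩ := (LinearMap.injective_iff_surjective_of_finrank_eq_finrank hd).1 hinj ⟨v, hv⟩
  have huv : V.starProjection u = v := congrArg Subtype.val hu'
  have e1 : ‖u - v‖ ≤ s * ‖u‖ := huv ▸ h u hu
  have e2 : ‖u - v‖ ^ 2 = ‖u‖ ^ 2 - ‖v‖ ^ 2 := by
    have := norm_sub_starProjection_sq V u
    rwa [huv] at this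
  have e3 : inner ℝ u v = ‖v‖ ^ 2 := by
    have := inner_starProjection_self V u
    rwa [huv] at this
  have e4 : inner ℝ (U.starProjection v) u = ‖v‖ ^ 2 := by
    rw [Submodule.inner_starProjection_left_eq_right, Submodule.starProjection_eq_self_iff.2 hu,
      real_inner_comm, e3]
  have e5 : ‖v‖ ^ 2 ≤ ‖U.starProjection v‖ * ‖u‖ := e4 ▸ real_inner_le_norm _ _
  refine le_of_sq_le_sq ?_ (by positivity)
  rw [norm_sub_starProjection_sq]
  rcases eq_or_ne u 0 with rfl | hu0
  · have : v = 0 := by rw [← huv, map_zero]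
    simp [this]
  have hu1 : 0 < ‖u‖ ^ 2 := by positivity
  have e6 : ‖u - v‖ ^ 2 ≤ (s * ‖u‖) ^ 2 := by gcongr
  have e7 : (‖v‖ ^ 2) ^ 2 ≤ (‖U.starProjection v‖ * ‖u‖) ^ 2 := by gcongr
  have e8 : (1 - s ^ 2) * ‖u‖ ^ 2 ≤ ‖v‖ ^ 2 := by nlinarith
  have e9 : ‖v‖ ^ 2 * ((1 - s ^ 2) * ‖u‖ ^ 2) ≤ ‖v‖ ^ 2 * ‖v‖ ^ 2 := by gcongr
  have e10 : ((1 - s ^ 2) * ‖v‖ ^ 2) * ‖u‖ ^ 2 ≤ ‖U.starProjection v‖ ^ 2 * ‖u‖ ^ 2 := by nlinarith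
  nlinarith [le_of_mul_le_mul_right e10 hu1]

/-- `σ` is a positive lower bound for the positive singular values of `f`. -/
def HasGap (f : E →ₗ[ℝ] F) (σ : ℝ) : Prop :=
  0 < σ ∧ ∀ v ∈ (LinearMap.ker f)ᗮ, σ * ‖v‖ ≤ ‖f v‖

lemma exists_mem_ker_orthogonal (f : E →ₗ[ℝ] F) {y : F} (hy : y ∈ LinearMap.range f) :
    ∃ v ∈ (LinearMap.ker f)ᗮ, f v = y := by
  obtain ⟨w, rfl⟩ := hy
  refine ⟨w - (LinearMap.ker f).starProjection w, Submodule.sub_starProjection_mem_orthogonal w, ?_⟩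
  have : f ((LinearMap.ker f).starProjection w) = 0 :=
    LinearMap.mem_ker.1 (Submodule.starProjection_apply_mem _ w)
  rw [map_sub, this, sub_zero]

/-- For y = f v with v orthogonal to the kernel, ‖y‖² = ⟨f* y, v⟩ ≤ ‖f* y‖ ‖v‖ and ‖v‖ ≤ ‖y‖ / σ.
This transfers column-space estimates to row spaces. -/
lemma HasGap.adjoint {f : E →ₗ[ℝ] F} {σ : ℝ} (h : HasGap f σ) : HasGap (LinearMap.adjoint f) σ := by
  refine ⟨h.1, fun y hy => ?_⟩
  have hy' : y ∈ LinearMap.range f := by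
    rwa [← LinearMap.orthogonal_range, Submodule.orthogonal_orthogonal] at hy
  obtain ⟨v, hv, rfl⟩ := exists_mem_ker_orthogonal f hy'
  have h1 := h.2 v hv
  have h2 : ‖f v‖ ^ 2 ≤ ‖LinearMap.adjoint f (f v)‖ * ‖v‖ := by
    rw [← real_inner_self_eq_norm_sq, ← LinearMap.adjoint_inner_left]
    exact real_inner_le_norm _ _
  rcases eq_or_ne (f v) 0 with h0 | h0
  · simp [h0]
  have h3 : 0 < ‖f v‖ := norm_pos_iff.2 h0
  have h4 : σ * ‖f v‖ ^ 2 ≤ ‖LinearMap.adjoint f (f v)‖ * (σ * ‖v‖) := by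
    nlinarith [mul_le_mul_of_nonneg_left h2 h.1.le]
  have h5 : ‖LinearMap.adjoint f (f v)‖ * (σ * ‖v‖) ≤ ‖LinearMap.adjoint f (f v)‖ * ‖f v‖ := by
    gcongr
  refine le_of_mul_le_mul_right ?_ h3
  nlinarith

/-- The preimage v of u orthogonal to the kernel has norm at most ‖u‖ / σ, and g v is a nearby
competitor in the range of g. Only the gap of f enters. -/
lemma HasGap.norm_sub_starProjection_range_le {f g : E →ₗ[ℝ] F} {σ K : ℝ} (h : HasGap f σ)
    (hK : 0 ≤ K) (hfg : ∀ v, ‖f v - g v‖ ≤ K * ‖v‖) (u : F) (hu : u ∈ LinearMap.range f) :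
    ‖u - (LinearMap.range g).starProjection u‖ ≤ K / σ * ‖u‖ := by
  obtain ⟨v, hv, rfl⟩ := exists_mem_ker_orthogonal f hu
  calc _ ≤ ‖f v - g v‖ := norm_sub_starProjection_le_of_mem _ _ (LinearMap.mem_range_self g v)
    _ ≤ K * ‖v‖ := hfg v
    _ ≤ K * (‖f v‖ / σ) := by
      gcongr
      rw [le_div_iff₀ h.1, mul_comm]
      exact h.2 v hv
    _ = _ := by ring

lemma hasGap_of_singularValues {f : E →ₗ[ℝ] F} {σ : ℝ} (hσ : 0 < σ)
    (h : ∀ i, 0 < f.singularValues i → σ ≤ f.singularValues i) : HasGap f σ := by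
  refine ⟨hσ, fun v hv => ?_⟩
  have hS := f.isSymmetric_adjoint_comp_self
  set b := hS.eigenvectorBasis rfl with hb
  have hbe : ∀ i, (LinearMap.adjoint f ∘ₗ f) (b i) = (hS.eigenvalues rfl i) • b i := fun i => by
    exact hS.apply_eigenvectorBasis rfl i
  have key : ∀ i, σ ^ 2 * (inner ℝ (b i) v) ^ 2 ≤
      inner ℝ ((LinearMap.adjoint f ∘ₗ f) v) (b i) * inner ℝ (b i) v := by
    intro i
    rw [hS v (b i), hbe, inner_smul_right, ← f.sq_singularValues_fin rfl i,
      real_inner_comm (b i) v, mul_assoc, ← sq]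
    rcases (f.singularValues_nonneg i).eq_or_lt with h0 | h0
    · have hk : b i ∈ LinearMap.ker f := by
        have h1 := hbe i
        rw [← f.sq_singularValues_fin rfl i, ← h0] at h1
        simp only [ne_eq, OfNat.ofNat_ne_zero, not_false_eq_true, zero_pow, zero_smul] at h1
        rwa [← LinearMap.mem_ker, LinearMap.ker_adjoint_comp_self] at h1
      have : inner ℝ (b i) v = 0 := hv _ hk
      simp [this]
    · have := h i h0
      gcongr
  have hsum := Finset.sum_le_sum fun i (_ : i ∈ Finset.univ) => key i
  rw [b.sum_inner_mul_inner, ← Finset.mul_sum, LinearMap.comp_apply, LinearMap.adjoint_inner_left,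
    real_inner_self_eq_norm_sq] at hsum
  have h2 : ∑ i, (inner ℝ (b i) v) ^ 2 = ‖v‖ ^ 2 := by
    rw [← real_inner_self_eq_norm_sq, ← b.sum_inner_mul_inner v v]
    exact Finset.sum_congr rfl fun i _ => by rw [real_inner_comm v (b i), sq]
  rw [h2] at hsum
  refine le_of_sq_le_sq ?_ (norm_nonneg _)
  linarith [mul_pow σ ‖v‖ 2]

lemma sigmaMinMatrix_hasGap {m l : Type*} [Fintype m] [Fintype l] [DecidableEq l]
    {M : Matrix m l ℝ} (hM : M ≠ 0) :
    HasGap (Matrix.toEuclideanLin M) (sigmaMinMatrix M) := by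
  set f := Matrix.toEuclideanLin M with hf
  have hf0 : f ≠ 0 := by simpa [hf] using hM
  have hr : 0 < Module.finrank ℝ (LinearMap.range f) := by
    rw [Nat.pos_iff_ne_zero]
    intro h0
    rw [Submodule.finrank_eq_zero, LinearMap.range_eq_bot] at h0
    exact hf0 h0
  -- Singular values are indexed from 0 and decrease, so the last positive one has index rank - 1; M
  -- ≠ 0 ensures that it exists.
  set N := Module.finrank ℝ (LinearMap.range f) - 1
  have hle : ∀ i, 0 < f.singularValues i → f.singularValues N ≤ f.singularValues i := by
    intro i hi
    rw [f.singularValues_pos_iff_lt_finrank_range] at hi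
    exact f.singularValues_antitone (by omega)
  have hpos : 0 < f.singularValues N := f.singularValues_pos_iff_lt_finrank_range.2 (by omega)
  have heq : sigmaMinMatrix M = f.singularValues N := by
    refine (IsLeast.csInf_eq ?_)
    refine ⟨⟨hpos, N, rfl⟩, ?_⟩
    rintro _ ⟨hs, i, rfl⟩
    exact hle i hs
  rw [heq]
  exact hasGap_of_singularValues hpos hle

/-- If two subspaces are close to each other in both directions, then the orthogonal projections
are close. -/
lemma norm_starProjection_sub_le {U V : Submodule ℝ E} {s : ℝ} (hs : 0 ≤ s)
    (hUV : ∀ v ∈ V, ‖v - U.starProjection v‖ ≤ s * ‖v‖)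
    (hVU : ∀ u ∈ U, ‖u - V.starProjection u‖ ≤ s * ‖u‖) :
    ‖U.starProjection - V.starProjection‖ ≤ s := by
  refine ContinuousLinearMap.opNorm_le_bound _ hs fun z => ?_
  set v := V.starProjection z with hv
  set w := z - v with hw
  have hvV : v ∈ V := V.starProjection_apply_mem z
  have hVw : V.starProjection w = 0 := by
    rw [hw, map_sub, ← hv, Submodule.starProjection_eq_self_iff.2 hvV, sub_self]
  -- The two terms lie in U and its orthogonal complement, and z = v + w is orthogonal too; adding
  -- squares therefore loses no constant.
  have hsplit : (U.starProjection - V.starProjection) z =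
      U.starProjection w - (v - U.starProjection v) := by
    rw [sub_apply, ← hv, hw, map_sub]
    abel
  have hUw : ‖U.starProjection w‖ ≤ s * ‖w‖ := by
    set u := U.starProjection w with hu
    have h1 : ‖u‖ ^ 2 = inner ℝ w (u - V.starProjection u) := by
      rw [inner_sub_right, ← Submodule.inner_starProjection_left_eq_right V, hVw, inner_zero_left,
        sub_zero, hu, inner_starProjection_self]
    have h2 : ‖u‖ ^ 2 ≤ ‖w‖ * (s * ‖u‖) := by
      rw [h1]
      refine (real_inner_le_norm _ _).trans ?_
      gcongr
      exact hVU u (U.starProjection_apply_mem w)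
    rcases (norm_nonneg u).eq_or_lt with h0 | h0
    · rw [← h0]; positivity
    · refine le_of_mul_le_mul_right ?_ h0
      nlinarith
  have horth : inner ℝ (U.starProjection w) (v - U.starProjection v) = 0 := by
    rw [real_inner_comm]
    exact U.starProjection_inner_eq_zero v _ (U.starProjection_apply_mem w)
  have hz : ‖z‖ ^ 2 = ‖v‖ ^ 2 + ‖w‖ ^ 2 := by
    rw [hw, hv, norm_sub_starProjection_sq]; ring
  rw [hsplit]
  refine le_of_sq_le_sq ?_ (by positivity)
  rw [norm_sub_sq_real, horth, mul_pow, hz]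
  have h1 : ‖U.starProjection w‖ ^ 2 ≤ (s * ‖w‖) ^ 2 := by gcongr
  have h2 : ‖v - U.starProjection v‖ ^ 2 ≤ (s * ‖v‖) ^ 2 := by gcongr; exact hUV v hvV
  nlinarith

/-- One gradient step with exact line search, under a restricted isometry property. -/
lemma norm_sub_lineSearch_le (U : Submodule ℝ E) (R : E →L[ℝ] E) {ρ e C : ℝ} (hρ : 0 < ρ)
    (he0 : 0 ≤ e) (he : e < 1) (hC : ‖R‖ ≤ C)
    (h : ‖U.starProjection - ρ • (U.starProjection ∘L R ∘L U.starProjection)‖ ≤ e) (D : E) :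
    ‖D - (‖U.starProjection (R D)‖ ^ 2 /
        inner ℝ (R (U.starProjection (R D))) (U.starProjection (R D))) • U.starProjection (R D)‖ ≤
      2 * e / (1 - e) * ‖D‖ + (1 + ρ * C / (1 - e)) * ‖D - U.starProjection D‖ := by
  set P := U.starProjection with hP
  set T := P - ρ • (P ∘L R ∘L P) with hT
  set Y := P (R D) with hY
  have hPle : ∀ x, ‖P x‖ ≤ ‖x‖ := U.norm_starProjection_apply_le
  have hPY : P Y = Y := Submodule.starProjection_eq_self_iff.2 (Submodule.starProjection_apply_mem _ _)
  have he1 : 0 < 1 - e := by linarith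
  have hinner : ρ * inner ℝ (R Y) Y = ‖Y‖ ^ 2 - inner ℝ (T Y) Y := by
    have : inner ℝ (P (R (P Y))) Y = inner ℝ (R Y) Y := by
      rw [hP, Submodule.inner_starProjection_left_eq_right, ← hP, hPY]
    simp only [hT, sub_apply, smul_apply,
      ContinuousLinearMap.comp_apply, inner_sub_left, inner_smul_left]
    rw [this, hPY, real_inner_self_eq_norm_sq]
    simp
  have hTY : |inner ℝ (T Y) Y| ≤ e * ‖Y‖ ^ 2 := by
    calc _ ≤ ‖T Y‖ * ‖Y‖ := abs_real_inner_le_norm _ _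
      _ ≤ (e * ‖Y‖) * ‖Y‖ := by gcongr; exact T.le_of_opNorm_le h Y
      _ = _ := by ring
  -- The normalized step size a lies in [1/(1+e), 1/(1-e)]. For Y = 0 the step is irrelevant and a =
  -- 1 serves.
  obtain ⟨a, ha1, ha2, haY⟩ : ∃ a : ℝ, 1 ≤ a * (1 + e) ∧ a * (1 - e) ≤ 1 ∧
      (‖Y‖ ^ 2 / inner ℝ (R Y) Y) • Y = (a * ρ) • Y := by
    rcases eq_or_ne Y 0 with h0 | h0
    · exact ⟨1, by linarith, by linarith, by simp [h0]⟩
    have hY0 : 0 < ‖Y‖ ^ 2 := by positivity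
    rw [abs_le] at hTY
    have hpos : 0 < ρ * inner ℝ (R Y) Y := by nlinarith
    refine ⟨‖Y‖ ^ 2 / (ρ * inner ℝ (R Y) Y), ?_, ?_, ?_⟩
    · rw [div_mul_eq_mul_div, le_div_iff₀ hpos]
      nlinarith
    · rw [div_mul_eq_mul_div, div_le_iff₀ hpos]
      nlinarith
    · congr 1
      have := (pos_iff_pos_of_mul_pos hpos).1 hρ
      field_simp
  have ha0 : 0 ≤ a := by nlinarith
  have haub : a ≤ 1 / (1 - e) := by rwa [le_div_iff₀ he1]
  have hae : |1 - a| + a * e ≤ 2 * e / (1 - e) := by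
    have h3 : (1 + e) / (1 - e) = 1 + 2 * e / (1 - e) := by field_simp; ring
    rcases le_total a 1 with h1 | h1
    · rw [abs_of_nonneg (by linarith)]
      rw [le_div_iff₀ he1]
      nlinarith
    · rw [abs_of_nonpos (by linarith)]
      have : a * (1 + e) ≤ 1 / (1 - e) * (1 + e) := by gcongr
      have h4 : 1 / (1 - e) * (1 + e) = 1 + 2 * e / (1 - e) := by rw [← h3]; ring
      linarith
  rw [haY]
  -- The tangential part of D meets the near-identity on U; the normal part enters only through its
  -- own size and its image under P R.
  have hdecomp : D - (a * ρ) • Y =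
      ((1 - a) • P D + a • T D) + ((D - P D) - (a * ρ) • P (R (D - P D))) := by
    have hPP : P (P D) = P D :=
      Submodule.starProjection_eq_self_iff.2 (Submodule.starProjection_apply_mem _ _)
    simp only [hT, hY, sub_apply, smul_apply,
      ContinuousLinearMap.comp_apply, map_sub, smul_sub, smul_smul, sub_smul, one_smul]
    abel
  rw [hdecomp]
  have b1 : ‖(1 - a) • P D + a • T D‖ ≤ 2 * e / (1 - e) * ‖D‖ := by
    calc _ ≤ |1 - a| * ‖P D‖ + a * ‖T D‖ := by
          refine (norm_add_le _ _).trans_eq ?_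
          rw [norm_smul, norm_smul, Real.norm_eq_abs, Real.norm_eq_abs, abs_of_nonneg ha0]
      _ ≤ |1 - a| * ‖D‖ + a * (e * ‖D‖) := by
          gcongr
          · exact hPle D
          · exact T.le_of_opNorm_le h D
      _ = (|1 - a| + a * e) * ‖D‖ := by ring
      _ ≤ _ := by gcongr
  have b2 : ‖(D - P D) - (a * ρ) • P (R (D - P D))‖ ≤ (1 + ρ * C / (1 - e)) * ‖D - P D‖ := by
    have hC0 : 0 ≤ C := (norm_nonneg _).trans hC
    calc _ ≤ ‖D - P D‖ + (a * ρ) * ‖P (R (D - P D))‖ := by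
          refine (norm_sub_le _ _).trans_eq ?_
          rw [norm_smul, Real.norm_eq_abs, abs_of_nonneg (by positivity)]
      _ ≤ ‖D - P D‖ + (1 / (1 - e) * ρ) * (C * ‖D - P D‖) := by
          gcongr
          exact (hPle _).trans (R.le_of_opNorm_le hC _)
      _ = _ := by ring
  exact (norm_add_le _ _).trans (add_le_add b1 b2)

end Hilbert

/-! ### Matricizations and linear operations on their columns and rows. -/

section Unfold

variable {I a b a' b' : Type*} [Fintype I] [Fintype a] [DecidableEq a] [Fintype b] [DecidableEq b]
  [Fintype a'] [DecidableEq a'] [Fintype b'] [DecidableEq b']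

/-- The matrix of a vector whose index set is split as a product. -/
def matricize (e : I ≃ a × b) (X : EuclideanSpace ℝ I) : Matrix a b ℝ :=
  Matrix.of fun i j => X (e.symm (i, j))

/-- The linear map of the matricization. -/
def matMap (e : I ≃ a × b) :
    EuclideanSpace ℝ I →ₗ[ℝ] EuclideanSpace ℝ b →ₗ[ℝ] EuclideanSpace ℝ a where
  toFun X := Matrix.toEuclideanLin (matricize e X)
  map_add' X Y := by rw [← map_add]; rfl
  map_smul' c X := by rw [← map_smul]; rfl

/-- The splitting with the two factors exchanged. -/
def flip (e : I ≃ a × b) : I ≃ b × a := e.trans (Equiv.prodComm a b)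

/-- A column of the matricization. -/
def column (e : I ≃ a × b) (j : b) : EuclideanSpace ℝ I →ₗ[ℝ] EuclideanSpace ℝ a where
  toFun X := WithLp.toLp 2 fun i => X (e.symm (i, j))
  map_add' _ _ := rfl
  map_smul' _ _ := rfl

/-- Application of a linear map to every column of the matricization. -/
def onColumns (e : I ≃ a × b) (Q : EuclideanSpace ℝ a →ₗ[ℝ] EuclideanSpace ℝ a) :
    EuclideanSpace ℝ I →ₗ[ℝ] EuclideanSpace ℝ I where
  toFun X := WithLp.toLp 2 fun i => Q (column e (e i).2 X) (e i).1
  map_add' X Y := by ext i; simp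
  map_smul' c X := by ext i; simp

lemma column_apply (e : I ≃ a × b) (j : b) (X : EuclideanSpace ℝ I) (i : a) :
    column e j X i = X (e.symm (i, j)) := rfl

lemma flip_flip (e : I ≃ a × b) : flip (flip e) = e := rfl

@[simp] lemma column_onColumns (e : I ≃ a × b) (Q : EuclideanSpace ℝ a →ₗ[ℝ] EuclideanSpace ℝ a)
    (j : b) (X : EuclideanSpace ℝ I) : column e j (onColumns e Q X) = Q (column e j X) := by
  ext i
  rw [column_apply]
  simp [onColumns]

lemma column_ext (e : I ≃ a × b) {X Y : EuclideanSpace ℝ I} (h : ∀ j, column e j X = column e j Y) :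
    X = Y := by
  ext i
  have := congrArg (fun z : EuclideanSpace ℝ a => z (e i).1) (h (e i).2)
  simpa [column_apply] using this

lemma matMap_single (e : I ≃ a × b) (X : EuclideanSpace ℝ I) (j : b) :
    matMap e X (EuclideanSpace.single j 1) = column e j X := by
  ext i
  simp [matMap, column_apply, matricize, Matrix.toLpLin_apply]

lemma matMap_eq_sum (e : I ≃ a × b) (X : EuclideanSpace ℝ I) (v : EuclideanSpace ℝ b) :
    matMap e X v = ∑ j, v j • column e j X := by
  ext i
  simp [matMap, column_apply, matricize, Matrix.toLpLin_apply, Matrix.mulVec, dotProduct, mul_comm]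

lemma matMap_onColumns (e : I ≃ a × b) (Q : EuclideanSpace ℝ a →ₗ[ℝ] EuclideanSpace ℝ a)
    (X : EuclideanSpace ℝ I) : matMap e (onColumns e Q X) = Q ∘ₗ matMap e X := by
  ext1 v
  simp [matMap_eq_sum]

lemma matMap_injective (e : I ≃ a × b) : Function.Injective (matMap e) := fun X Y h =>
  column_ext e fun j => by rw [← matMap_single, ← matMap_single, h]

lemma matMap_flip (e : I ≃ a × b) (X : EuclideanSpace ℝ I) :
    matMap (flip e) X = LinearMap.adjoint (matMap e X) := by
  rw [matMap, LinearMap.coe_mk, AddHom.coe_mk, matMap, LinearMap.coe_mk, AddHom.coe_mk,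
    ← Matrix.toEuclideanLin_conjTranspose_eq_adjoint]
  rfl

lemma matMap_onColumns_flip (e : I ≃ a × b) (Q : EuclideanSpace ℝ b →ₗ[ℝ] EuclideanSpace ℝ b)
    (X : EuclideanSpace ℝ I) :
    matMap e (onColumns (flip e) Q X) = matMap e X ∘ₗ LinearMap.adjoint Q := by
  rw [← flip_flip e, matMap_flip, matMap_flip (flip e) X, flip_flip, matMap_onColumns,
    LinearMap.adjoint_comp]

lemma inner_eq_sum_column (e : I ≃ a × b) (X Y : EuclideanSpace ℝ I) :
    inner ℝ X Y = ∑ j, inner ℝ (column e j X) (column e j Y) := by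
  simp only [PiLp.inner_apply, column_apply]
  rw [← Finset.sum_comm, ← Fintype.sum_prod_type', ← e.sum_comp]
  simp

lemma norm_sq_eq_sum_column (e : I ≃ a × b) (X : EuclideanSpace ℝ I) :
    ‖X‖ ^ 2 = ∑ j, ‖column e j X‖ ^ 2 := by
  simp_rw [← real_inner_self_eq_norm_sq]
  exact inner_eq_sum_column e X X

lemma norm_matMap_apply_le (e : I ≃ a × b) (X : EuclideanSpace ℝ I) (v : EuclideanSpace ℝ b) :
    ‖matMap e X v‖ ≤ ‖X‖ * ‖v‖ := by
  refine le_of_sq_le_sq ?_ (by positivity)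
  rw [mul_pow, norm_sq_eq_sum_column e, EuclideanSpace.norm_sq_eq v, mul_comm, matMap_eq_sum]
  refine le_trans ?_ (Finset.sum_mul_sq_le_sq_mul_sq _ _ _)
  gcongr
  refine (norm_sum_le _ _).trans_eq ?_
  simp [norm_smul]

lemma norm_onColumns_le (e : I ≃ a × b) {Q : EuclideanSpace ℝ a →ₗ[ℝ] EuclideanSpace ℝ a} {s : ℝ}
    (hs : 0 ≤ s) (hQ : ∀ v, ‖Q v‖ ≤ s * ‖v‖) (X : EuclideanSpace ℝ I) :
    ‖onColumns e Q X‖ ≤ s * ‖X‖ := by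
  refine le_of_sq_le_sq ?_ (by positivity)
  rw [mul_pow, norm_sq_eq_sum_column e, norm_sq_eq_sum_column e, Finset.mul_sum]
  refine Finset.sum_le_sum fun j _ => ?_
  rw [column_onColumns, ← mul_pow]
  gcongr
  exact hQ _

lemma inner_onColumns_left (e : I ≃ a × b) {Q : EuclideanSpace ℝ a →ₗ[ℝ] EuclideanSpace ℝ a}
    (hQ : Q.IsSymmetric) (X Y : EuclideanSpace ℝ I) :
    inner ℝ (onColumns e Q X) Y = inner ℝ X (onColumns e Q Y) := by
  rw [inner_eq_sum_column e, inner_eq_sum_column e]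
  simp only [column_onColumns]
  exact Finset.sum_congr rfl fun j _ => hQ _ _

lemma onColumns_comp (e : I ≃ a × b) (Q Q' : EuclideanSpace ℝ a →ₗ[ℝ] EuclideanSpace ℝ a)
    (X : EuclideanSpace ℝ I) : onColumns e (Q ∘ₗ Q') X = onColumns e Q (onColumns e Q' X) :=
  column_ext e fun j => by simp

lemma onColumns_sub (e : I ≃ a × b) (Q Q' : EuclideanSpace ℝ a →ₗ[ℝ] EuclideanSpace ℝ a)
    (X : EuclideanSpace ℝ I) : onColumns e (Q - Q') X = onColumns e Q X - onColumns e Q' X :=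
  column_ext e fun j => by simp

/-- Replacement of the first component of an index. -/
def replaceFst (e : I ≃ a × b) (i : I) (x : a) : I := e.symm (x, (e i).2)

/-- Two splittings whose first components can be varied independently. -/
def IndepFst (e : I ≃ a × b) (e' : I ≃ a' × b') : Prop :=
  ∀ i x y, (e' (replaceFst e i x)).1 = (e' i).1 ∧ (e (replaceFst e' i y)).1 = (e i).1 ∧
    replaceFst e' (replaceFst e i x) y = replaceFst e (replaceFst e' i y) x

lemma onColumns_apply (e : I ≃ a × b) (Q : EuclideanSpace ℝ a →ₗ[ℝ] EuclideanSpace ℝ a)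
    (X : EuclideanSpace ℝ I) (i : I) :
    onColumns e Q X i =
      ∑ x, Q (EuclideanSpace.single x 1) (e i).1 * X (replaceFst e i x) := by
  have h : column e (e i).2 X = ∑ x, X (replaceFst e i x) • EuclideanSpace.single x (1 : ℝ) := by
    ext y
    simp [column_apply, replaceFst, Finset.sum_apply, Pi.single_apply]
  change Q (column e (e i).2 X) (e i).1 = _
  rw [h, map_sum]
  simp [mul_comm]

/-- In either order the entry at i is the same double sum over independently replaced components. -/
lemma IndepFst.onColumns_comm {e : I ≃ a × b} {e' : I ≃ a' × b'} (h : IndepFst e e')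
    (Q : EuclideanSpace ℝ a →ₗ[ℝ] EuclideanSpace ℝ a)
    (Q' : EuclideanSpace ℝ a' →ₗ[ℝ] EuclideanSpace ℝ a') (X : EuclideanSpace ℝ I) :
    onColumns e Q (onColumns e' Q' X) = onColumns e' Q' (onColumns e Q X) := by
  ext i
  simp only [onColumns_apply, Finset.mul_sum]
  rw [Finset.sum_comm]
  refine Finset.sum_congr rfl fun y _ => Finset.sum_congr rfl fun x _ => ?_
  obtain ⟨h1, h2, h3⟩ := h i x y
  rw [h1, h2, h3]
  ring

lemma IndepFst.symm {e : I ≃ a × b} {e' : I ≃ a' × b'} (h : IndepFst e e') : IndepFst e' e :=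
  fun i x y => ⟨(h i y x).2.1, (h i y x).1, (h i y x).2.2.symm⟩

lemma indepFst_flip (e : I ≃ a × b) : IndepFst e (flip e) := fun i x y => by
  simp [replaceFst, flip]

/-- The orthogonal projection of all columns onto the column space of the matricization of `X`. -/
def colProj (e : I ≃ a × b) (X : EuclideanSpace ℝ I) :
    EuclideanSpace ℝ I →ₗ[ℝ] EuclideanSpace ℝ I :=
  onColumns e (LinearMap.range (matMap e X)).starProjection

lemma column_mem_range (e : I ≃ a × b) (X : EuclideanSpace ℝ I) (j : b) :
    column e j X ∈ LinearMap.range (matMap e X) := ⟨_, matMap_single e X j⟩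

lemma colProj_self (e : I ≃ a × b) (X : EuclideanSpace ℝ I) : colProj e X X = X :=
  column_ext e fun j => by
    rw [colProj, column_onColumns]
    exact Submodule.starProjection_eq_self_iff.2 (column_mem_range e X j)

lemma colProj_idem (e : I ≃ a × b) (X Y : EuclideanSpace ℝ I) :
    colProj e X (colProj e X Y) = colProj e X Y :=
  column_ext e fun j => by
    rw [colProj, column_onColumns, column_onColumns]
    exact Submodule.starProjection_eq_self_iff.2 (Submodule.starProjection_apply_mem _ _)

lemma inner_colProj_left (e : I ≃ a × b) (X Y Z : EuclideanSpace ℝ I) :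
    inner ℝ (colProj e X Y) Z = inner ℝ Y (colProj e X Z) :=
  inner_onColumns_left e (Submodule.starProjection_isSymmetric _) Y Z

lemma norm_colProj_le (e : I ≃ a × b) (X Y : EuclideanSpace ℝ I) : ‖colProj e X Y‖ ≤ ‖Y‖ := by
  have := norm_onColumns_le e (Q := ((LinearMap.range (matMap e X)).starProjection :
    EuclideanSpace ℝ a →ₗ[ℝ] EuclideanSpace ℝ a)) zero_le_one
    (fun v => by simpa using Submodule.norm_starProjection_apply_le _ v) Y
  simpa [colProj] using this

lemma norm_colProj_sq_add (e : I ≃ a × b) (X Y : EuclideanSpace ℝ I) :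
    ‖colProj e X Y‖ ^ 2 + ‖Y - colProj e X Y‖ ^ 2 = ‖Y‖ ^ 2 := by
  have h : inner ℝ Y (colProj e X Y) = ‖colProj e X Y‖ ^ 2 := by
    rw [← real_inner_self_eq_norm_sq, inner_colProj_left, colProj_idem]
  rw [norm_sub_sq_real, h]
  ring

/-- The projected columns of Y are combinations of the columns of X, so the result is X times a
matrix on the right, that is, a row operation on X. -/
lemma colProj_eq_onColumns_flip (e : I ≃ a × b) (X Y : EuclideanSpace ℝ I) :
    ∃ B, colProj e X Y = onColumns (flip e) B X := by
  set f := matMap e X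
  set g := (LinearMap.range f).starProjection.toLinearMap ∘ₗ matMap e Y
  have hg : ∀ v, g v ∈ LinearMap.range f := fun v => Submodule.starProjection_apply_mem _ _
  obtain ⟨h, hh⟩ := Module.projective_lifting_property f.rangeRestrict (g.codRestrict _ hg)
    f.surjective_rangeRestrict
  refine ⟨LinearMap.adjoint h, matMap_injective e ?_⟩
  rw [matMap_onColumns_flip, LinearMap.adjoint_adjoint, colProj, matMap_onColumns]
  ext1 v
  have := congrArg Subtype.val (LinearMap.congr_fun hh v)
  exact this.symm

/-- An operation that fixes `X`, and acts independently of the row operations, fixes the vectors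
with columns in the column space of `X`. -/
lemma IndepFst.onColumns_colProj {e : I ≃ a × b} {e' : I ≃ a' × b'} (h : IndepFst e' (flip e))
    {Q : EuclideanSpace ℝ a' →ₗ[ℝ] EuclideanSpace ℝ a'} {X : EuclideanSpace ℝ I}
    (hQ : onColumns e' Q X = X) (Y : EuclideanSpace ℝ I) :
    onColumns e' Q (colProj e X Y) = colProj e X Y := by
  obtain ⟨B, hB⟩ := colProj_eq_onColumns_flip e X Y
  rw [hB, h.onColumns_comm, hQ]

lemma norm_colProj_sub_le (e : I ≃ a × b) {A X : EuclideanSpace ℝ I} {s : ℝ} (hs : 0 ≤ s)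
    (h : ∀ v ∈ LinearMap.range (matMap e A),
      ‖v - (LinearMap.range (matMap e X)).starProjection v‖ ≤ s * ‖v‖) (Y : EuclideanSpace ℝ I) :
    ‖colProj e A Y - colProj e X (colProj e A Y)‖ ≤ s * ‖Y‖ := by
  set p := ((LinearMap.range (matMap e A)).starProjection :
    EuclideanSpace ℝ a →ₗ[ℝ] EuclideanSpace ℝ a) with hp
  set q := ((LinearMap.range (matMap e X)).starProjection :
    EuclideanSpace ℝ a →ₗ[ℝ] EuclideanSpace ℝ a) with hq
  have : colProj e A Y - colProj e X (colProj e A Y) = onColumns e (p - q ∘ₗ p) Y := by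
    rw [onColumns_sub, onColumns_comp]
    rfl
  rw [this]
  refine norm_onColumns_le e hs (fun v => ?_) Y
  refine (h (p v) (Submodule.starProjection_apply_mem _ _)).trans ?_
  gcongr
  exact Submodule.norm_starProjection_apply_le _ v

lemma HasGap.norm_colProj_sub_le {e : I ≃ a × b} {A X : EuclideanSpace ℝ I} {σ : ℝ}
    (h : HasGap (matMap e A) σ) (Y : EuclideanSpace ℝ I) :
    ‖colProj e A Y - colProj e X (colProj e A Y)‖ ≤ ‖X - A‖ / σ * ‖Y‖ :=
  TTCompletion.norm_colProj_sub_le e (div_nonneg (norm_nonneg _) h.1.le)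
    (h.norm_sub_starProjection_range_le (norm_nonneg _) fun v => by
      rw [← LinearMap.sub_apply, ← map_sub, norm_sub_rev X A]
      exact norm_matMap_apply_le e _ v) Y

lemma finrank_range_matMap (e : I ≃ a × b) (X : EuclideanSpace ℝ I) :
    Module.finrank ℝ (LinearMap.range (matMap e X)) = (matricize e X).rank := by
  rw [Matrix.rank_eq_finrank_range_toLin (matricize e X) (EuclideanSpace.basisFun a ℝ).toBasis
    (EuclideanSpace.basisFun b ℝ).toBasis, ← Matrix.toEuclideanLin_eq_toLin_orthonormal]
  rfl

lemma HasGap.norm_colProj_sub_le_symm {e : I ≃ a × b} {A X : EuclideanSpace ℝ I} {σ : ℝ}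
    (h : HasGap (matMap e A) σ) (hr : (matricize e A).rank = (matricize e X).rank)
    (Y : EuclideanSpace ℝ I) :
    ‖colProj e X Y - colProj e A (colProj e X Y)‖ ≤ ‖X - A‖ / σ * ‖Y‖ := by
  have hs : 0 ≤ ‖X - A‖ / σ := div_nonneg (norm_nonneg _) h.1.le
  refine TTCompletion.norm_colProj_sub_le e hs
    (norm_sub_starProjection_le_symm ?_ hs
      (h.norm_sub_starProjection_range_le (norm_nonneg _) fun v => ?_)) Y
  · rw [finrank_range_matMap, finrank_range_matMap, hr]
  · rw [← LinearMap.sub_apply, ← map_sub, norm_sub_rev X A]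
    exact norm_matMap_apply_le e _ v

lemma HasGap.matMap_flip {e : I ≃ a × b} {A : EuclideanSpace ℝ I} {σ : ℝ} (h : HasGap (matMap e A) σ) :
    HasGap (matMap (flip e) A) σ := by
  rw [TTCompletion.matMap_flip]
  exact h.adjoint

lemma rank_matricize_flip (e : I ≃ a × b) (X : EuclideanSpace ℝ I) :
    (matricize (flip e) X).rank = (matricize e X).rank := by
  rw [← Matrix.rank_transpose]
  rfl

end Unfold

/-! ### Normal parts for a single matricization of fixed rank. -/

section Tangent

variable {I a b : Type*} [Fintype I] [Fintype a] [DecidableEq a] [Fintype b] [DecidableEq b]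

/-- The component of a vector normal at `X` to the set of matrices of the same rank. -/
def normalPart (e : I ≃ a × b) (X : EuclideanSpace ℝ I) :
    EuclideanSpace ℝ I →ₗ[ℝ] EuclideanSpace ℝ I :=
  (LinearMap.id - colProj e X) ∘ₗ (LinearMap.id - colProj (flip e) X)

lemma normalPart_apply (e : I ≃ a × b) (X Y : EuclideanSpace ℝ I) :
    normalPart e X Y = (Y - colProj (flip e) X Y) - colProj e X (Y - colProj (flip e) X Y) := rfl

lemma colProj_comm_flip (e : I ≃ a × b) (X X' Y : EuclideanSpace ℝ I) :
    colProj e X (colProj (flip e) X' Y) = colProj (flip e) X' (colProj e X Y) :=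
  (indepFst_flip e).onColumns_comm _ _ _

lemma normalPart_apply' (e : I ≃ a × b) (X Y : EuclideanSpace ℝ I) :
    normalPart e X Y = (Y - colProj e X Y) - colProj (flip e) X (Y - colProj e X Y) := by
  rw [normalPart_apply, map_sub, map_sub, colProj_comm_flip]
  abel

lemma norm_sub_colProj_le (e : I ≃ a × b) (X Y : EuclideanSpace ℝ I) :
    ‖Y - colProj e X Y‖ ≤ ‖Y‖ := by
  refine le_of_sq_le_sq ?_ (norm_nonneg _)
  nlinarith [norm_colProj_sq_add e X Y, sq_nonneg ‖colProj e X Y‖]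

/-- The column and row spaces of `A` are within `s` of those of `X`. -/
def SpacesClose (e : I ≃ a × b) (A X : EuclideanSpace ℝ I) (s : ℝ) : Prop :=
  (∀ Y, colProj e A Y = Y → ‖Y - colProj e X Y‖ ≤ s * ‖Y‖) ∧
    ∀ Y, colProj (flip e) A Y = Y → ‖Y - colProj (flip e) X Y‖ ≤ s * ‖Y‖

lemma HasGap.spacesClose {e : I ≃ a × b} {A : EuclideanSpace ℝ I} {σ : ℝ}
    (h : HasGap (matMap e A) σ) (X : EuclideanSpace ℝ I) : SpacesClose e A X (‖X - A‖ / σ) :=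
  ⟨fun Y hY => by simpa [hY] using h.norm_colProj_sub_le (X := X) Y,
    fun Y hY => by simpa [hY] using h.matMap_flip.norm_colProj_sub_le (X := X) Y⟩

lemma HasGap.spacesClose_symm {e : I ≃ a × b} {A X : EuclideanSpace ℝ I} {σ : ℝ}
    (h : HasGap (matMap e A) σ) (hr : (matricize e A).rank = (matricize e X).rank) :
    SpacesClose e X A (‖X - A‖ / σ) :=
  ⟨fun Y hY => by simpa [hY] using h.norm_colProj_sub_le_symm hr Y,
    fun Y hY => by
      have hr' : (matricize (flip e) A).rank = (matricize (flip e) X).rank := by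
        rw [rank_matricize_flip, rank_matricize_flip, hr]
      simpa [hY] using h.matMap_flip.norm_colProj_sub_le_symm hr' Y⟩

/-- Both factors are small. The row complement annihilates X, so it sees only A - X; its output
still has columns in the column space of A, so the column complement contributes s. -/
lemma SpacesClose.norm_normalPart_self_le {e : I ≃ a × b} {A X : EuclideanSpace ℝ I} {s : ℝ}
    (h : SpacesClose e A X s) (hs : 0 ≤ s) : ‖normalPart e X A‖ ≤ s * ‖A - X‖ := by
  have hfix : colProj e A (A - colProj (flip e) X A) = A - colProj (flip e) X A := by
    rw [map_sub, colProj_comm_flip, colProj_self]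
  have hdiff : A - colProj (flip e) X A = (A - X) - colProj (flip e) X (A - X) := by
    rw [map_sub, colProj_self]
    abel
  rw [normalPart_apply]
  refine (h.1 _ hfix).trans ?_
  gcongr
  rw [hdiff]
  exact norm_sub_colProj_le _ _ _

/-- Y splits orthogonally into u, with columns in the column space of A, and w, with rows in its row
space. Each has normal part at X at most s times its norm, and √2 bounds (‖u‖ + ‖w‖) / ‖Y‖. -/
lemma SpacesClose.norm_normalPart_le {e : I ≃ a × b} {A X Y : EuclideanSpace ℝ I} {s : ℝ}
    (h : SpacesClose e A X s) (hs : 0 ≤ s) (hY : normalPart e A Y = 0) :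
    ‖normalPart e X Y‖ ≤ √2 * s * ‖Y‖ := by
  set u := colProj e A Y with hu
  set w := Y - u with hw
  have hwfix : colProj (flip e) A w = w := by
    rw [normalPart_apply', ← hu, ← hw, sub_eq_zero] at hY
    exact hY.symm
  have h1 : ‖normalPart e X u‖ ≤ s * ‖u‖ := by
    rw [normalPart_apply']
    exact (norm_sub_colProj_le _ _ _).trans (h.1 u (colProj_idem e A Y))
  have h2 : ‖normalPart e X w‖ ≤ s * ‖w‖ := by
    rw [normalPart_apply]
    exact (norm_sub_colProj_le _ _ _).trans (h.2 w hwfix)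
  have h3 : ‖u‖ ^ 2 + ‖w‖ ^ 2 = ‖Y‖ ^ 2 := norm_colProj_sq_add e A Y
  have h4 : ‖u‖ + ‖w‖ ≤ √2 * ‖Y‖ := by
    refine le_of_sq_le_sq ?_ (by positivity)
    rw [mul_pow, Real.sq_sqrt (by norm_num)]
    nlinarith [sq_nonneg (‖u‖ - ‖w‖)]
  calc ‖normalPart e X Y‖ = ‖normalPart e X u + normalPart e X w‖ := by
        rw [← map_add, hw, add_sub_cancel]
    _ ≤ s * ‖u‖ + s * ‖w‖ := (norm_add_le _ _).trans (add_le_add h1 h2)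
    _ = s * (‖u‖ + ‖w‖) := by ring
    _ ≤ s * (√2 * ‖Y‖) := by gcongr
    _ = _ := by ring

/-- The velocity of a curve of matrices of constant rank has no normal part. -/
lemma HasGap.normalPart_velocity {e : I ≃ a × b} {γ : ℝ → EuclideanSpace ℝ I}
    {v : EuclideanSpace ℝ I} {σ : ℝ} (h : HasGap (matMap e (γ 0)) σ) (hγ : HasDerivAt γ v 0)
    (hr : ∀ᶠ s in 𝓝 (0 : ℝ), (matricize e (γ 0)).rank = (matricize e (γ s)).rank) :
    normalPart e (γ 0) v = 0 := by
  set N := LinearMap.toContinuousLinearMap (normalPart e (γ 0)) with hN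
  have h1 : HasDerivAt (fun s => N (γ s)) (N v) 0 := N.hasFDerivAt.comp_hasDerivAt 0 hγ
  have hN0 : N (γ 0) = 0 := by
    change normalPart e (γ 0) (γ 0) = 0
    rw [normalPart_apply, colProj_self, sub_self, map_zero, sub_zero]
  -- Constant rank makes the normal part of γ s quadratic in the displacement, hence O(s²), so its
  -- derivative N v vanishes.
  have hO : (fun s => N (γ s)) =O[𝓝 0] fun s => ‖γ s - γ 0‖ ^ 2 := by
    refine Asymptotics.IsBigO.of_bound (1 / σ) ?_
    filter_upwards [hr] with s hs
    have := (h.spacesClose_symm hs).norm_normalPart_self_le (div_nonneg (norm_nonneg _) h.1.le)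
    rw [Real.norm_of_nonneg (by positivity)]
    refine this.trans_eq ?_
    ring
  have hγO : (fun s => γ s - γ 0) =O[𝓝 0] fun s : ℝ => s := by
    simpa using hγ.isBigO_sub
  have hO2 : (fun s => N (γ s)) =O[𝓝 0] fun s : ℝ => s ^ 2 := hO.trans (hγO.norm_left.pow 2)
  have hlo : (fun s => N (γ s)) =o[𝓝 0] fun s : ℝ => s :=
    hO2.trans_isLittleO (by simpa using Asymptotics.isLittleO_pow_pow (𝕜 := ℝ) one_lt_two)
  have h2 : HasDerivAt (fun s => N (γ s)) 0 0 := by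
    rw [hasDerivAt_iff_isLittleO]
    simpa [hN0] using hlo
  exact h1.unique h2

lemma rank_matricize_le_of_colProj (e : I ≃ a × b) {X Y : EuclideanSpace ℝ I}
    (h : colProj e X Y = Y) : (matricize e Y).rank ≤ (matricize e X).rank := by
  rw [← finrank_range_matMap, ← finrank_range_matMap]
  refine Submodule.finrank_mono ?_
  rintro _ ⟨v, rfl⟩
  rw [← h, colProj, matMap_onColumns]
  exact Submodule.starProjection_apply_mem _ _

lemma HasGap.rank_matricize_le {e : I ≃ a × b} {A X : EuclideanSpace ℝ I} {σ : ℝ}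
    (h : HasGap (matMap e A) σ) (hX : ‖X - A‖ < σ) :
    (matricize e A).rank ≤ (matricize e X).rank := by
  rw [← finrank_range_matMap, ← finrank_range_matMap]
  refine finrank_le_of_norm_sub_starProjection_le ((div_lt_one h.1).2 hX)
    (h.norm_sub_starProjection_range_le (norm_nonneg _) fun v => ?_)
  rw [← LinearMap.sub_apply, ← map_sub, norm_sub_rev X A]
  exact norm_matMap_apply_le e _ v

end Tangent

/-! ### Tangent spaces of the fixed TT-rank set. -/

section TensorTrain

variable {d : ℕ} {n : Fin d → ℕ}

/-- The splitting of a multi-index into its first `k` and its last `d - k` indices. -/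
def split (n : Fin d → ℕ) (k : ℕ) : MultiIndex n ≃ RowIndex n k × ColIndex n k :=
  Equiv.piEquivPiSubtypeProd (fun j : Fin d => j.val < k) (fun j => Fin (n j))

lemma indepFst_split {j k : ℕ} (h : j ≤ k) : IndepFst (split n j) (flip (split n k)) := by
  intro i x y
  refine ⟨?_, ?_, ?_⟩
  · funext ⟨q, hq⟩
    have : ¬ q.val < j := by omega
    simp [flip, split, replaceFst, Equiv.piEquivPiSubtypeProd, this]
  · funext ⟨q, hq⟩
    have : q.val < k := by omega
    simp [flip, split, replaceFst, Equiv.piEquivPiSubtypeProd, this]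
  · funext q
    simp only [flip, split, replaceFst, Equiv.piEquivPiSubtypeProd, Equiv.trans_apply,
      Equiv.symm_trans_apply, Equiv.coe_fn_mk, Equiv.coe_fn_symm_mk, Equiv.prodComm_apply,
      Equiv.prodComm_symm, Prod.swap]
    split_ifs <;> first | rfl | omega

/-- The projection onto the column space of the `k`-th unfolding; the identity for `k = 0`. -/
def leftProj (X : Tensor n) (k : ℕ) : Tensor n →ₗ[ℝ] Tensor n :=
  if k = 0 then LinearMap.id else colProj (split n k) X

/-- The projection onto the row space of the `k`-th unfolding. -/
def rightProj (X : Tensor n) (k : ℕ) : Tensor n →ₗ[ℝ] Tensor n := colProj (flip (split n k)) X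

lemma norm_leftProj_le (X : Tensor n) (k : ℕ) (Y : Tensor n) : ‖leftProj X k Y‖ ≤ ‖Y‖ := by
  unfold leftProj
  split_ifs
  · exact le_rfl
  · exact norm_colProj_le _ _ _

/-- Nestedness of TT spaces: the k-th projection is a row operation applied to X, and such
operations commute with the j-th projection, which fixes X. -/
lemma leftProj_leftProj (X : Tensor n) {j k : ℕ} (h : j ≤ k) (Y : Tensor n) :
    leftProj X j (leftProj X k Y) = leftProj X k Y := by
  unfold leftProj
  split_ifs with h1 h2 h2
  · rfl
  · rfl
  · omega
  · exact (indepFst_split h).onColumns_colProj (colProj_self _ X) Y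

lemma rightProj_rightProj (X : Tensor n) {j k : ℕ} (h : j ≤ k) (Y : Tensor n) :
    rightProj X k (rightProj X j Y) = rightProj X j Y :=
  IndepFst.onColumns_colProj (e := flip (split n j)) (e' := flip (split n k))
    (indepFst_split h).symm (colProj_self _ X) Y

lemma rightProj_leftProj (X : Tensor n) {j k : ℕ} (h : j ≤ k) (Y : Tensor n) :
    rightProj X k (leftProj X j Y) = leftProj X j (rightProj X k Y) := by
  unfold leftProj
  split_ifs
  · rfl
  · exact (indepFst_split h).symm.onColumns_comm _ _ _

lemma rank_unfolding {r : Fin (d - 1) → ℕ} {X : Tensor n} (hX : X ∈ fixedRank n r) (k : Fin (d - 1)) :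
    (matricize (split n (k + 1)) X).rank = r k := congrFun hX k

lemma hasGap_unfolding {X : Tensor n} (hX : X ≠ 0) (k : ℕ) :
    HasGap (matMap (split n k) X) (sigmaMinMatrix (unfolding k X)) := by
  refine sigmaMinMatrix_hasGap fun h => hX (matMap_injective (split n k) ?_)
  rw [map_zero]
  change Matrix.toEuclideanLin (unfolding k X) = 0
  exact (congrArg _ h).trans (map_zero _)

/-- The line X + sY already stays in the set: keeping a column or row space prevents each rank from
growing, and for small s the gap prevents it from dropping. -/
lemma mem_tangentSpaceAt {r : Fin (d - 1) → ℕ} {X : Tensor n} (hX : X ∈ fixedRank n r)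
    (hX0 : X ≠ 0) {Y : Tensor n}
    (hY : ∀ k : Fin (d - 1), leftProj X (k + 1) Y = Y ∨ rightProj X (k + 1) Y = Y) :
    Y ∈ tangentSpaceAt (fixedRank n r) X := by
  refine Submodule.subset_span ⟨fun s => X + s • Y, by fun_prop, by simp, ?_, ?_⟩
  · have hcont : Tendsto (fun s : ℝ => ‖X + s • Y - X‖) (𝓝 0) (𝓝 0) := by
      have : Continuous fun s : ℝ => ‖X + s • Y - X‖ := by fun_prop
      simpa using this.tendsto 0
    have hev : ∀ᶠ s in 𝓝 (0 : ℝ), ∀ k : Fin (d - 1),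
        ‖X + s • Y - X‖ < sigmaMinMatrix (unfolding (k + 1) X) :=
      eventually_all.2 fun k => hcont.eventually_lt_const (hasGap_unfolding hX0 (k + 1)).1
    filter_upwards [hev] with s hs
    funext k
    rw [← rank_unfolding hX k]
    refine le_antisymm ?_ ((hasGap_unfolding hX0 (k + 1)).rank_matricize_le (hs k))
    change (matricize (split n (k + 1)) (X + s • Y)).rank ≤ _
    rcases hY k with h | h
    · refine rank_matricize_le_of_colProj _ ?_
      rw [leftProj, if_neg (Nat.succ_ne_zero _)] at h
      rw [map_add, map_smul, colProj_self, h]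
    · rw [← rank_matricize_flip, ← rank_matricize_flip _ X]
      refine rank_matricize_le_of_colProj _ ?_
      rw [rightProj] at h
      rw [map_add, map_smul, colProj_self, h]
  · simpa using ((hasDerivAt_id (0 : ℝ)).smul_const Y).const_add X

lemma normalPart_of_mem_tangentSpaceAt {r : Fin (d - 1) → ℕ} {X : Tensor n}
    (hX : X ∈ fixedRank n r) (hX0 : X ≠ 0) {Y : Tensor n}
    (hY : Y ∈ tangentSpaceAt (fixedRank n r) X) (k : Fin (d - 1)) :
    normalPart (split n (k + 1)) X Y = 0 := by
  suffices h : tangentSpaceAt (fixedRank n r) X ≤ LinearMap.ker (normalPart (split n (k + 1)) X) from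
    h hY
  refine Submodule.span_le.2 ?_
  rintro v ⟨γ, -, rfl, hγ, hv⟩
  refine (hasGap_unfolding hX0 (k + 1)).normalPart_velocity hv ?_
  filter_upwards [hγ] with s hs
  rw [rank_unfolding hX, rank_unfolding hs]

lemma self_mem_tangentSpaceAt {r : Fin (d - 1) → ℕ} {X : Tensor n} (hX : X ∈ fixedRank n r)
    (hX0 : X ≠ 0) : X ∈ tangentSpaceAt (fixedRank n r) X :=
  mem_tangentSpaceAt hX hX0 fun _ => Or.inr (colProj_self _ X)

/-- The distance to the tangent space is controlled by the normal parts for all unfoldings. -/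
lemma norm_sub_tangentProj_le {r : Fin (d - 1) → ℕ} {X : Tensor n} (hX : X ∈ fixedRank n r)
    (hX0 : X ≠ 0) (Y : Tensor n) :
    ‖Y - tangentProj r X Y‖ ≤ ∑ k : Fin (d - 1), ‖normalPart (split n (k + 1)) X Y‖ := by
  set L := leftProj X
  set R := rightProj X
  -- An explicit tangent vector: the k-th summand is fixed by left projections up to index k and by
  -- right projections from k + 1 on. Telescoping from L 0 = id leaves in Y - Z only the terms L_k
  -- (I - L_{k+1})(I - R_{k+1}) Y.
  set Z := L (d - 1) Y + ∑ k ∈ Finset.range (d - 1), (L k (R (k + 1) Y) - L (k + 1) (R (k + 1) Y))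
    with hZ
  have hZmem : Z ∈ tangentSpaceAt (fixedRank n r) X := by
    refine Submodule.add_mem _ (mem_tangentSpaceAt hX hX0 fun i => Or.inl ?_)
      (Submodule.sum_mem _ fun k _ => mem_tangentSpaceAt hX hX0 fun i => ?_)
    · exact leftProj_leftProj X (by omega) Y
    · rcases le_or_gt (i.val + 1) k with hik | hik
      · left
        rw [map_sub, leftProj_leftProj X hik, leftProj_leftProj X (by omega)]
      · right
        rw [map_sub, rightProj_leftProj X (by omega), rightProj_leftProj X (by omega),
          rightProj_rightProj X (by omega)]
  have hdiff : Y - Z = ∑ k ∈ Finset.range (d - 1),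
      L k ((Y - R (k + 1) Y) - L (k + 1) (Y - R (k + 1) Y)) := by
    have htel : Y - L (d - 1) Y = ∑ k ∈ Finset.range (d - 1), (L k Y - L (k + 1) Y) := by
      rw [Finset.sum_range_sub' (fun k => L k Y)]
      simp [L, leftProj]
    rw [hZ, ← sub_sub, htel, ← Finset.sum_sub_distrib]
    refine Finset.sum_congr rfl fun k _ => ?_
    simp only [map_sub, L, leftProj_leftProj X (Nat.le_succ k)]
    abel
  refine (norm_sub_starProjection_le_of_mem _ Y hZmem).trans ?_
  rw [hdiff, Fin.sum_univ_eq_sum_range fun k => ‖normalPart (split n (k + 1)) X Y‖]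
  refine (norm_sum_le _ _).trans (Finset.sum_le_sum fun k _ => (norm_leftProj_le X k _).trans_eq ?_)
  simp only [L, R, normalPart_apply, leftProj, rightProj, Nat.succ_ne_zero, if_false]

lemma one_div_sigmaMin (X : Tensor n) :
    1 / sigmaMin X = ∑ k : Fin (d - 1), 1 / sigmaMinMatrix (unfolding (k + 1) X) := by
  rw [sigmaMin, one_div, inv_inv]

lemma div_sigmaMin (X : Tensor n) (c : ℝ) :
    c / sigmaMin X = ∑ k : Fin (d - 1), c / sigmaMinMatrix (unfolding (k + 1) X) := by
  rw [div_eq_mul_one_div, one_div_sigmaMin, Finset.mul_sum]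
  exact Finset.sum_congr rfl fun k _ => (div_eq_mul_one_div _ _).symm

variable {r : Fin (d - 1) → ℕ} {A X : Tensor n}

lemma ne_zero_of_mem_fixedRank (hd : 2 ≤ d) (hA : A ∈ fixedRank n r) (hX : X ∈ fixedRank n r)
    (hA0 : A ≠ 0) : X ≠ 0 := by
  rintro rfl
  apply hA0
  have k : Fin (d - 1) := ⟨0, by omega⟩
  refine matMap_injective (split n (k + 1)) ?_
  rw [map_zero, ← LinearMap.range_eq_bot, ← Submodule.finrank_eq_zero, finrank_range_matMap,
    rank_unfolding hA, ← rank_unfolding hX, ← finrank_range_matMap, map_zero, LinearMap.range_zero,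
    finrank_bot]

/-- The curvature of the manifold `𝓜_r`. -/
lemma norm_sub_tangentProj_self_le (hX : X ∈ fixedRank n r)
    (hA0 : A ≠ 0) (hX0 : X ≠ 0) :
    ‖(X - A) - tangentProj r X (X - A)‖ ≤ ‖X - A‖ / sigmaMin A * ‖X - A‖ := by
  have hXX : tangentProj r X X = X :=
    Submodule.starProjection_eq_self_iff.2 (self_mem_tangentSpaceAt hX hX0)
  -- X is tangent at itself, so only the normal component of A matters.
  have : (X - A) - tangentProj r X (X - A) = -(A - tangentProj r X A) := by
    rw [map_sub, hXX]; abel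
  rw [this, norm_neg, div_sigmaMin, Finset.sum_mul]
  refine (norm_sub_tangentProj_le hX hX0 A).trans (Finset.sum_le_sum fun k _ => ?_)
  have hg := hasGap_unfolding hA0 (k + 1)
  have := (hg.spacesClose X).norm_normalPart_self_le (div_nonneg (norm_nonneg _) hg.1.le)
  rwa [norm_sub_rev A X] at this

/-- Both one-sided gaps are measured by σ_min(A): from X to A, equal ranks replace the unknown
singular values of X. -/
lemma norm_tangentProj_sub_le (hA : A ∈ fixedRank n r) (hX : X ∈ fixedRank n r)
    (hA0 : A ≠ 0) (hX0 : X ≠ 0) :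
    ‖tangentProj r X - tangentProj r A‖ ≤ √2 * (‖X - A‖ / sigmaMin A) := by
  have hnn : ∀ k : Fin (d - 1), 0 ≤ ‖X - A‖ / sigmaMinMatrix (unfolding (k + 1) A) := fun k =>
    div_nonneg (norm_nonneg _) (hasGap_unfolding hA0 _).1.le
  have hδ : 0 ≤ ‖X - A‖ / sigmaMin A := by
    rw [div_sigmaMin]
    exact Finset.sum_nonneg fun k _ => hnn k
  refine norm_starProjection_sub_le (by positivity) (fun v hv => ?_) (fun v hv => ?_)
  · refine (norm_sub_tangentProj_le hX hX0 v).trans ?_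
    rw [div_sigmaMin, Finset.mul_sum, Finset.sum_mul]
    refine Finset.sum_le_sum fun k _ => ?_
    exact ((hasGap_unfolding hA0 (k + 1)).spacesClose X).norm_normalPart_le (hnn k)
      (normalPart_of_mem_tangentSpaceAt hA hA0 hv k)
  · refine (norm_sub_tangentProj_le hA hA0 v).trans ?_
    rw [div_sigmaMin, Finset.mul_sum, Finset.sum_mul]
    refine Finset.sum_le_sum fun k _ => ?_
    exact ((hasGap_unfolding hA0 (k + 1)).spacesClose_symm
      ((rank_unfolding hA k).trans (rank_unfolding hX k).symm)).norm_normalPart_le (hnn k)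
      (normalPart_of_mem_tangentSpaceAt hX hX0 hv k)

end TensorTrain

/-! ### Best approximation by a truncated singular value decomposition. -/

section TruncatedSVD

variable {I a b : Type*} [Fintype I] [Fintype a] [DecidableEq a] [Fintype b] [DecidableEq b]

/-- Weights in `[0, 1]` with sum at most `r` are best placed on the `r` leading terms of an
antitone sequence. -/
lemma sum_mul_le_sum_leading {q r : ℕ} {c p : Fin q → ℝ} (hc : Antitone c) (hc0 : ∀ i, 0 ≤ c i)
    (hp0 : ∀ i, 0 ≤ p i) (hp1 : ∀ i, p i ≤ 1) (hp : ∑ i, p i ≤ r) :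
    ∑ i, c i * p i ≤ ∑ i : Fin q with i.val < r, c i := by
  rw [Finset.sum_filter]
  rcases le_or_gt q r with hqr | hqr
  · refine Finset.sum_le_sum fun i _ => ?_
    rw [if_pos (by omega)]
    exact mul_le_of_le_one_right (hc0 i) (hp1 i)
  -- Subtracting the threshold c_r makes the comparison hold term by term.
  set τ := c ⟨r, hqr⟩
  have hτ : 0 ≤ τ := hc0 _
  have hcard : (∑ i : Fin q, if i.val < r then (1 : ℝ) else 0) = r := by
    rw [Fin.sum_univ_eq_sum_range (fun i => if i < r then (1 : ℝ) else 0), ← Finset.sum_filter,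
      Finset.sum_const, nsmul_eq_mul, mul_one]
    congr 1
    rw [show (Finset.range q).filter (· < r) = Finset.range r by ext i; simp; omega,
      Finset.card_range]
  have hterm : ∀ i, (c i - τ) * p i ≤ (if i.val < r then c i else 0) - τ * (if i.val < r then 1 else 0) := by
    intro i
    split_ifs with hi
    · have : τ ≤ c i := hc (Fin.le_def.2 hi.le)
      nlinarith [hp1 i]
    · have : c i ≤ τ := hc (Fin.le_def.2 (by simpa using hi))
      nlinarith [hp0 i]
  have hsum := Finset.sum_le_sum fun i (_ : i ∈ Finset.univ) => hterm i
  rw [Finset.sum_sub_distrib, ← Finset.mul_sum, hcard] at hsum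
  have hsplit : ∑ i, (c i - τ) * p i = ∑ i, c i * p i - τ * ∑ i, p i := by
    rw [Finset.mul_sum, ← Finset.sum_sub_distrib]
    exact Finset.sum_congr rfl fun i _ => by ring
  nlinarith

/-- Expand in an orthonormal basis of U, exchange the sums, and apply Bessel's inequality to each
basis vector. -/
lemma sum_norm_starProjection_sq_le {E : Type*} [NormedAddCommGroup E] [InnerProductSpace ℝ E]
    [FiniteDimensional ℝ E] (U : Submodule ℝ E) {q : ℕ} {u : Fin q → E} (hu : Orthonormal ℝ u) :
    ∑ i, ‖U.starProjection (u i)‖ ^ 2 ≤ Module.finrank ℝ U := by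
  set w := stdOrthonormalBasis ℝ U
  have h1 : ∀ x, ‖U.starProjection x‖ ^ 2 = ∑ j, (inner ℝ (w j : E) x) ^ 2 := by
    intro x
    set y : U := ⟨U.starProjection x, U.starProjection_apply_mem x⟩
    have h2 : ‖U.starProjection x‖ ^ 2 = inner ℝ y y := (real_inner_self_eq_norm_sq _).symm
    rw [h2, ← w.sum_inner_mul_inner y y]
    refine Finset.sum_congr rfl fun j _ => ?_
    have h3 : inner ℝ (w j) y = inner ℝ (w j : E) x := by
      change inner ℝ (w j : E) (U.starProjection x) = _
      rw [← Submodule.inner_starProjection_left_eq_right,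
        Submodule.starProjection_eq_self_iff.2 (w j).2]
    rw [real_inner_comm, h3, sq]
  simp_rw [h1]
  rw [Finset.sum_comm]
  have h4 : ∀ j, ∑ i, (inner ℝ (w j : E) (u i)) ^ 2 ≤ 1 := by
    intro j
    have := hu.sum_inner_products_le (w j : E) (s := Finset.univ)
    have hw : ‖(w j : E)‖ = 1 := w.orthonormal.1 j
    rw [hw] at this
    simpa [real_inner_comm] using this
  refine (Finset.sum_le_sum fun j _ => h4 j).trans ?_
  simp

lemma norm_sq_of_column_eq (e : I ≃ a × b) {q : ℕ} {v : Fin q → EuclideanSpace ℝ b}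
    (hv : Orthonormal ℝ v) (z : Fin q → EuclideanSpace ℝ a) {Z : EuclideanSpace ℝ I}
    (hZ : ∀ j, column e j Z = ∑ i, v i j • z i) : ‖Z‖ ^ 2 = ∑ i, ‖z i‖ ^ 2 := by
  have horth : ∀ i i', ∑ j, v i j * v i' j = if i = i' then 1 else 0 := by
    intro i i'
    rw [← (orthonormal_iff_ite.1 hv) i i']
    simp [PiLp.inner_apply, mul_comm]
  have h1 : ∀ j, ‖column e j Z‖ ^ 2 = ∑ i, ∑ i', (v i j * v i' j) * inner ℝ (z i) (z i') := by
    intro j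
    rw [← real_inner_self_eq_norm_sq, hZ, sum_inner]
    refine Finset.sum_congr rfl fun i _ => ?_
    rw [inner_sum]
    refine Finset.sum_congr rfl fun i' _ => ?_
    rw [inner_smul_left, inner_smul_right]
    simp [mul_assoc]
  rw [norm_sq_eq_sum_column e, Finset.sum_congr rfl fun j _ => h1 j, Finset.sum_comm]
  refine Finset.sum_congr rfl fun i _ => ?_
  rw [Finset.sum_comm]
  simp_rw [← Finset.sum_mul, horth]
  simp

/-- The projection onto the span of the `r` leading vectors. -/
def leadingProj {E : Type*} [NormedAddCommGroup E] [InnerProductSpace ℝ E]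
    [FiniteDimensional ℝ E] (r : ℕ) {q : ℕ} (u : Fin q → E) : E →ₗ[ℝ] E :=
  (Submodule.span ℝ (u '' {i | i.val < r})).starProjection

lemma leadingProj_apply {E : Type*} [NormedAddCommGroup E] [InnerProductSpace ℝ E]
    [FiniteDimensional ℝ E] (r : ℕ) {q : ℕ} {u : Fin q → E} (hu : Orthonormal ℝ u) (i : Fin q) :
    leadingProj r u (u i) = if i.val < r then u i else 0 := by
  split_ifs with h
  · exact Submodule.starProjection_eq_self_iff.2 (Submodule.subset_span ⟨i, h, rfl⟩)
  · refine (Submodule.starProjection_apply_eq_zero_iff _).2 ?_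
    rw [Submodule.mem_orthogonal]
    intro x hx
    induction hx using Submodule.span_induction with
    | mem x hx =>
      obtain ⟨j, hj, rfl⟩ := hx
      exact hu.2 fun hji => h (hji ▸ hj)
    | zero => exact inner_zero_left _
    | add x y _ _ hx hy => rw [inner_add_left, hx, hy, add_zero]
    | smul c x _ hx => rw [inner_smul_left, hx, mul_zero]

/-- `Y` is a best approximation of `X` by a rank-`r` matricization, obtained by an orthogonal
projection of the columns as well as of the rows. -/
structure IsTruncation (e : I ≃ a × b) (r : ℕ) (X Y : EuclideanSpace ℝ I) : Prop where
  onColumns : ∃ Q : EuclideanSpace ℝ a →ₗ[ℝ] EuclideanSpace ℝ a, Q.IsSymmetric ∧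
    (∀ v, ‖Q v‖ ≤ ‖v‖) ∧ onColumns e Q X = Y ∧ onColumns e Q Y = Y
  onRows : ∃ Q : EuclideanSpace ℝ b →ₗ[ℝ] EuclideanSpace ℝ b, TTCompletion.onColumns (flip e) Q X = Y
  rank_le : (matricize e Y).rank ≤ r
  norm_sub_le : ∀ B, (matricize e B).rank ≤ r → ‖X - Y‖ ≤ ‖X - B‖

lemma IsTruncatedSVD.isTruncation {e : I ≃ a × b} {r : ℕ} {X Y : EuclideanSpace ℝ I}
    (h : IsTruncatedSVD r (matricize e X) (matricize e Y)) : IsTruncation e r X Y := by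
  obtain ⟨q, σ, u, v, hσ, hσ0, hu, hv, hX, hY⟩ := h
  have hXc : ∀ j, column e j X = ∑ i, v i j • (σ i • u i) := by
    intro j
    ext x
    have := congrFun (congrFun hX x) j
    simp only [matricize, Matrix.of_apply, Matrix.sum_apply, Matrix.smul_apply,
      Matrix.vecMulVec_apply, smul_eq_mul] at this
    rw [column_apply, this]
    simp only [WithLp.ofLp_sum, Finset.sum_apply, smul_eq_mul, WithLp.ofLp_smul, Pi.smul_apply]
    exact Finset.sum_congr rfl fun i _ => by ring
  have hYc : ∀ j, column e j Y = ∑ i, v i j • (if i.val < r then σ i • u i else 0) := by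
    intro j
    ext x
    have := congrFun (congrFun hY x) j
    rw [Finset.sum_filter] at this
    simp only [matricize, Matrix.of_apply, Matrix.sum_apply] at this
    rw [column_apply, this]
    simp only [WithLp.ofLp_sum, Finset.sum_apply, WithLp.ofLp_smul, Pi.smul_apply, smul_eq_mul]
    refine Finset.sum_congr rfl fun i _ => ?_
    split_ifs
    · simp [Matrix.vecMulVec_apply]; ring
    · simp
  have hXr : ∀ j, column (flip e) j X = ∑ i, u i j • (σ i • v i) := by
    intro x
    ext j
    have h1 := congrArg (fun z : EuclideanSpace ℝ a => z x) (hXc j)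
    change column e j X x = _
    refine h1.trans ?_
    simp only [WithLp.ofLp_sum, Finset.sum_apply, WithLp.ofLp_smul, Pi.smul_apply, smul_eq_mul]
    exact Finset.sum_congr rfl fun i _ => by ring
  have hYr : ∀ j, column (flip e) j Y = ∑ i, u i j • (if i.val < r then σ i • v i else 0) := by
    intro x
    ext j
    have h1 := congrArg (fun z : EuclideanSpace ℝ a => z x) (hYc j)
    change column e j Y x = _
    refine h1.trans ?_
    simp only [WithLp.ofLp_sum, Finset.sum_apply, WithLp.ofLp_smul, Pi.smul_apply, smul_eq_mul]
    refine Finset.sum_congr rfl fun i _ => ?_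
    split_ifs
    · simp; ring
    · simp
  set Q := leadingProj r u with hQ
  have hQX : onColumns e Q X = Y := column_ext e fun j => by
    rw [column_onColumns, hXc, hYc, map_sum]
    simp only [map_smul, hQ, leadingProj_apply r hu, smul_ite, smul_zero]
  have hQsymm : Q.IsSymmetric := Submodule.starProjection_isSymmetric _
  have hQQ : onColumns e Q Y = Y := by
    rw [← hQX, ← onColumns_comp]
    congr 2
    ext1 z
    exact Submodule.starProjection_eq_self_iff.2 (Submodule.starProjection_apply_mem _ _)
  have hnormX : ∀ T : EuclideanSpace ℝ a →ₗ[ℝ] EuclideanSpace ℝ a,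
      ‖onColumns e T X‖ ^ 2 = ∑ i, σ i ^ 2 * ‖T (u i)‖ ^ 2 := by
    intro T
    rw [norm_sq_of_column_eq e hv (fun i => σ i • T (u i))]
    · simp [norm_smul, mul_pow]
    · intro j
      rw [column_onColumns, hXc]
      simp
  have hnormY : ‖Y‖ ^ 2 = ∑ i : Fin q with i.val < r, σ i ^ 2 := by
    rw [← hQX, hnormX, Finset.sum_filter]
    refine Finset.sum_congr rfl fun i _ => ?_
    rw [hQ, leadingProj_apply r hu]
    split_ifs
    · rw [hu.1 i]; ring
    · simp
  refine ⟨⟨Q, hQsymm, fun z => Submodule.norm_starProjection_apply_le _ z, hQX, hQQ⟩,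
    ⟨leadingProj r v, column_ext (flip e) fun j => ?_⟩, ?_, fun B hB => ?_⟩
  · rw [column_onColumns, hXr, hYr, map_sum]
    simp only [map_smul, leadingProj_apply r hv, smul_ite, smul_zero]
  · rw [← finrank_range_matMap]
    have hle : LinearMap.range (matMap e Y) ≤ Submodule.span ℝ (u '' {i | i.val < r}) := by
      rintro _ ⟨z, rfl⟩
      rw [← hQX, matMap_onColumns]
      exact Submodule.starProjection_apply_mem _ _
    refine (Submodule.finrank_mono hle).trans ?_
    have hS : (u '' {i : Fin q | i.val < r}) =
        ((Finset.univ.filter fun i : Fin q => i.val < r).image u : Set (EuclideanSpace ℝ a)) := by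
      simp
    rw [hS]
    refine (finrank_span_finset_le_card _).trans (Finset.card_image_le.trans ?_)
    have : (Finset.univ.filter fun i : Fin q => i.val < r).card =
        ((Finset.univ.filter fun i : Fin q => i.val < r).map Fin.valEmbedding).card := by simp
    rw [this]
    refine (Finset.card_le_card (t := Finset.range r) fun x hx => ?_).trans_eq (Finset.card_range r)
    simp only [Finset.mem_map, Finset.mem_filter] at hx
    obtain ⟨i, hi, rfl⟩ := hx
    exact Finset.mem_range.2 hi.2
  -- Eckart–Young: B may be replaced by the projection of X onto its column space, whose squared
  -- norm is ∑ σ_i² p_i with weights p_i = ‖P u_i‖² in [0, 1] of sum at most r.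
  · have h1 : ‖X - colProj e B X‖ ≤ ‖X - B‖ := by
      have : X - colProj e B X = (X - B) - colProj e B (X - B) := by
        rw [map_sub, colProj_self]
        abel
      rw [this]
      exact norm_sub_colProj_le _ _ _
    refine le_trans ?_ h1
    refine le_of_sq_le_sq ?_ (norm_nonneg _)
    have h2 := norm_colProj_sq_add e B X
    have h3 : ‖X - Y‖ ^ 2 = ‖X‖ ^ 2 - ‖Y‖ ^ 2 := by
      have : inner ℝ X Y = ‖Y‖ ^ 2 := by
        rw [← real_inner_self_eq_norm_sq]
        nth_rewrite 1 [← hQQ]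
        rw [← inner_onColumns_left e hQsymm, hQX]
      rw [norm_sub_sq_real, this]
      ring
    have h4 : ‖colProj e B X‖ ^ 2 ≤ ‖Y‖ ^ 2 := by
      rw [colProj, hnormX, hnormY]
      refine sum_mul_le_sum_leading (fun i j hij => pow_le_pow_left₀ (hσ0 j) (hσ hij) 2)
        (fun i => by positivity) (fun i => by positivity) (fun i => ?_) ?_
      · rw [← one_pow 2, ← hu.1 i]
        gcongr
        exact Submodule.norm_starProjection_apply_le _ _
      · refine (sum_norm_starProjection_sq_le _ hu).trans ?_
        rw [finrank_range_matMap]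
        exact_mod_cast hB
    linarith

end TruncatedSVD

/-! ### Quasi-optimality of the TT-SVD. -/

section TTSVD

variable {d : ℕ} {n : Fin d → ℕ} {r : Fin (d - 1) → ℕ}

/-- An operation on the first `j` indices does not increase the rank of the `k`-th unfolding,
`j ≤ k`. -/
lemma rank_onColumns_split_le {j k : ℕ} (hjk : j ≤ k)
    (Q : EuclideanSpace ℝ (RowIndex n j) →ₗ[ℝ] EuclideanSpace ℝ (RowIndex n j)) (X : Tensor n) :
    (matricize (split n k) (onColumns (split n j) Q X)).rank ≤ (matricize (split n k) X).rank := by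
  rw [← rank_matricize_flip, ← rank_matricize_flip _ X]
  refine rank_matricize_le_of_colProj _ ?_
  rw [colProj, ← (indepFst_split hjk).onColumns_comm, ← colProj, colProj_self]

lemma rank_onColumns_flip_split_le {j k : ℕ} (hjk : j ≤ k)
    (Q : EuclideanSpace ℝ (ColIndex n k) →ₗ[ℝ] EuclideanSpace ℝ (ColIndex n k)) (X : Tensor n) :
    (matricize (split n j) (onColumns (flip (split n k)) Q X)).rank ≤
      (matricize (split n j) X).rank := by
  refine rank_matricize_le_of_colProj _ ?_
  rw [colProj, (indepFst_split hjk).onColumns_comm, ← colProj, colProj_self]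

variable {Y : ℕ → Tensor n}

/-- Later truncations act on trailing indices only, so they cannot raise a rank already reduced. -/
lemma rank_truncations_le
    (hY : ∀ k : Fin (d - 1), IsTruncation (split n (k + 1)) (r k) (Y k) (Y (k + 1)))
    (k : Fin (d - 1)) {j : ℕ} (hkj : k + 1 ≤ j) (hj : j ≤ d - 1) :
    (matricize (split n (k + 1)) (Y j)).rank ≤ r k := by
  induction j, hkj using Nat.le_induction with
  | base => exact (hY k).rank_le
  | succ j hkj ih =>
    obtain ⟨Q, hQ⟩ := (hY ⟨j, by omega⟩).onRows
    rw [← hQ]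
    exact (rank_onColumns_flip_split_le (by simp; omega) Q _).trans (ih (by omega))

/-- The symmetric column operation Q of a truncation annihilates the discarded part and fixes every
later iterate, since later truncations are row operations commuting with Q. Hence the errors add in
squares. -/
lemma inner_truncations
    (hY : ∀ k : Fin (d - 1), IsTruncation (split n (k + 1)) (r k) (Y k) (Y (k + 1)))
    {k : ℕ} {j : ℕ} (hkj : k ≤ j) (hj : j ≤ d - 1) : inner ℝ (Y 0 - Y k) (Y j) = 0 := by
  induction k generalizing j with
  | zero => simp
  | succ k ih =>
    obtain ⟨Q, hQs, -, hQ1, hQ2⟩ := (hY ⟨k, by omega⟩).onColumns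
    simp only at hQ1 hQ2
    have hfix : onColumns (split n (k + 1)) Q (Y j) = Y j := by
      induction j, hkj using Nat.le_induction with
      | base => exact hQ2
      | succ j hkj ih' =>
        obtain ⟨T, hT⟩ := (hY ⟨j, by omega⟩).onRows
        simp only at hT
        rw [← hT, (indepFst_split (by omega)).onColumns_comm, ih' (by omega) Q hQs hQ1 hQ2]
    have h1 : inner ℝ (Y k - Y (k + 1)) (Y j) = 0 := by
      rw [← hfix, ← inner_onColumns_left _ hQs, map_sub, hQ1, hQ2, sub_self, inner_zero_left]
    rw [← sub_add_sub_cancel (Y 0) (Y k), inner_add_left, ih (by omega) hj, h1, add_zero]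

/-- The competitor B is A after the same column operations as the iterates: it gets no farther away
and keeps the rank bounds still to be used. Thus each truncation costs at most ‖Y 0 - A‖. -/
lemma norm_truncations_sq_le
    (hY : ∀ k : Fin (d - 1), IsTruncation (split n (k + 1)) (r k) (Y k) (Y (k + 1)))
    {A : Tensor n} (hA : ∀ k : Fin (d - 1), (matricize (split n (k + 1)) A).rank ≤ r k)
    {k : ℕ} (hk : k ≤ d - 1) :
    ‖Y 0 - Y k‖ ^ 2 ≤ k * ‖Y 0 - A‖ ^ 2 ∧ ∃ B : Tensor n, ‖Y k - B‖ ≤ ‖Y 0 - A‖ ∧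
      ∀ j : Fin (d - 1), k ≤ j → (matricize (split n (j + 1)) B).rank ≤ r j := by
  induction k with
  | zero => exact ⟨by simp, A, le_rfl, fun j _ => hA j⟩
  | succ k ih =>
    obtain ⟨h1, B, hB, hBr⟩ := ih (by omega)
    have ht := hY ⟨k, by omega⟩
    obtain ⟨Q, -, hQn, hQ1, -⟩ := ht.onColumns
    simp only at hQ1
    refine ⟨?_, onColumns (split n (k + 1)) Q B, ?_, fun j hj => ?_⟩
    · have h2 : ‖Y k - Y (k + 1)‖ ≤ ‖Y 0 - A‖ := (ht.norm_sub_le B (hBr ⟨k, by omega⟩ le_rfl)).trans hB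
      have h3 : ‖Y k - Y (k + 1)‖ ^ 2 ≤ ‖Y 0 - A‖ ^ 2 := by gcongr
      have h4 : inner ℝ (Y 0 - Y k) (Y k - Y (k + 1)) = 0 := by
        rw [inner_sub_right, inner_truncations hY le_rfl (by omega),
          inner_truncations hY (Nat.le_succ k) hk, sub_zero]
      rw [← sub_add_sub_cancel (Y 0) (Y k), norm_add_sq_real, h4]
      push_cast
      linarith
    · rw [← hQ1, ← map_sub]
      refine (norm_onColumns_le _ zero_le_one (by simpa using hQn) _).trans ?_
      rwa [one_mul]
    · exact (rank_onColumns_split_le (show k + 1 ≤ j + 1 by omega) Q B).trans (hBr j (by omega))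

variable {Z W A : Tensor n}

lemma IsTTSVD.rank_le (h : IsTTSVD r Z W) (k : Fin (d - 1)) : (unfolding (k + 1) W).rank ≤ r k := by
  obtain ⟨Y, -, rfl, hY⟩ := h
  exact rank_truncations_le (fun k => IsTruncatedSVD.isTruncation (hY k)) k (by omega) le_rfl

/-- Quasi-optimality of the truncated TT-SVD. -/
lemma IsTTSVD.norm_sub_le (hd : 2 ≤ d) (h : IsTTSVD r Z W) (hA : A ∈ fixedRank n r) :
    ‖W - A‖ ≤ (1 + √((d : ℝ) - 1)) * ‖Z - A‖ := by
  obtain ⟨Y, rfl, rfl, hY⟩ := h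
  have h1 := (norm_truncations_sq_le (fun k => IsTruncatedSVD.isTruncation (hY k))
    (fun k => (rank_unfolding hA k).le) le_rfl).1
  have hcast : ((d - 1 : ℕ) : ℝ) = (d : ℝ) - 1 := by
    rw [Nat.cast_sub (by omega), Nat.cast_one]
  rw [hcast] at h1
  have h2 : ‖Y 0 - Y (d - 1)‖ ≤ √((d : ℝ) - 1) * ‖Y 0 - A‖ := by
    refine le_of_sq_le_sq ?_ (by positivity)
    rwa [mul_pow, Real.sq_sqrt (by rw [← hcast]; positivity)]
  calc ‖Y (d - 1) - A‖ = ‖(Y 0 - A) - (Y 0 - Y (d - 1))‖ := by congr 1; abel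
    _ ≤ ‖Y 0 - A‖ + ‖Y 0 - Y (d - 1)‖ := norm_sub_le _ _
    _ ≤ _ := by linarith

end TTSVD

/-! ### Inequalities for the contraction factor. -/

section Scalar

/-- With `δ` the relative error and `K = C ρ⁻¹`: the bound obtained for one step is below the
contraction factor. -/
lemma contraction_lt {ε δ C K : ℝ} (hε : 0 ≤ ε) (hδ : 0 < δ) (hC : 0 ≤ C) (hK : 0 ≤ K)
    (h : ε + 2 * δ * (1 + 2 * K) < 1) :
    2 * (ε + 3 / 2 * δ * (1 + 2 * K)) / (1 - (ε + 3 / 2 * δ * (1 + 2 * K))) +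
        (1 + K / (1 - (ε + 3 / 2 * δ * (1 + 2 * K)))) * δ <
      2 * (ε + 2 * δ * (1 + 2 * K)) / (1 - (ε + 2 * δ * (1 + 2 * K))) +
        (1 + C / (1 - (ε + 2 * δ * (1 + 2 * K)))) * δ := by
  set e := ε + 3 / 2 * δ * (1 + 2 * K) with he
  set E := ε + 2 * δ * (1 + 2 * K) with hE
  have hKδ : 0 ≤ K * δ := by positivity
  have heE : e ≤ E := by rw [he, hE]; nlinarith
  have hE1 : 0 < 1 - E := by linarith
  have he1 : 0 < 1 - e := by linarith
  -- The slack is 2(E - e) = δ(1 + 2K), which exceeds Kδ.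
  have hnum : 2 * e + K * δ < 2 * E := by rw [he, hE]; nlinarith
  have h1 : (2 * e + K * δ) / (1 - e) < 2 * E / (1 - E) := by
    have he0 : 0 ≤ 2 * e + K * δ := by positivity
    calc (2 * e + K * δ) / (1 - e) ≤ (2 * e + K * δ) / (1 - E) := by gcongr
      _ < 2 * E / (1 - E) := by gcongr
  have h2 : 0 ≤ C / (1 - E) * δ := by positivity
  have h3 : 2 * e / (1 - e) + (1 + K / (1 - e)) * δ = (2 * e + K * δ) / (1 - e) + δ := by ring
  rw [h3]
  linarith

lemma contraction_mono {ε δ δ' C K s : ℝ} (hε : 0 ≤ ε) (hδ : 0 ≤ δ) (hδδ' : δ ≤ δ') (hC : 0 ≤ C)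
    (hK : 0 ≤ K) (hs : 0 ≤ s) (h : ε + 2 * δ' * (1 + 2 * K) < 1) :
    (1 + s) * (2 * (ε + 2 * δ * (1 + 2 * K)) / (1 - (ε + 2 * δ * (1 + 2 * K))) +
        (1 + C / (1 - (ε + 2 * δ * (1 + 2 * K)))) * δ) ≤
      (1 + s) * (2 * (ε + 2 * δ' * (1 + 2 * K)) / (1 - (ε + 2 * δ' * (1 + 2 * K))) +
        (1 + C / (1 - (ε + 2 * δ' * (1 + 2 * K)))) * δ') := by
  have hE1 : 0 < 1 - (ε + 2 * δ' * (1 + 2 * K)) := by linarith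
  have : 0 ≤ δ' := hδ.trans hδδ'
  gcongr

/-- After clearing denominators, the factor being below 1 is a quadratic inequality in δ whose δ²
term helps. Dropping that term leaves exactly the linear condition `h`; the bound on ε makes its
right-hand side positive. -/
lemma contraction_lt_one {ε δ C K s : ℝ} (hε : 0 < ε) (hδ : 0 ≤ δ) (hC : 0 ≤ C) (hK : 0 ≤ K)
    (hs : 1 ≤ s) (hε1 : ε < (3 + 2 * s)⁻¹)
    (h : δ < (5 + C + 8 * K + (2 + 4 * K) / (1 + s) - ε)⁻¹ * ((1 - ε) / (1 + s) - 2 * ε)) :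
    ε + 2 * δ * (1 + 2 * K) < 1 ∧ δ < 1 ∧
      (1 + s) * (2 * (ε + 2 * δ * (1 + 2 * K)) / (1 - (ε + 2 * δ * (1 + 2 * K))) +
        (1 + C / (1 - (ε + 2 * δ * (1 + 2 * K)))) * δ) < 1 := by
  have hs1 : 0 < 1 + s := by linarith
  have hε2 : ε * (3 + 2 * s) < 1 := by
    rwa [← one_div, lt_div_iff₀ (by linarith)] at hε1
  have hε3 : ε < 1 := by nlinarith
  have hq : 0 ≤ (2 + 4 * K) / (1 + s) := by positivity
  rw [inv_mul_eq_div, lt_div_iff₀ (by linarith)] at h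
  have h' : δ * ((5 + C + 8 * K - ε) * (1 + s) + (2 + 4 * K)) < (1 - ε) - 2 * ε * (1 + s) := by
    have := mul_lt_mul_of_pos_right h hs1
    have e1 : δ * (5 + C + 8 * K + (2 + 4 * K) / (1 + s) - ε) * (1 + s) =
        δ * ((5 + C + 8 * K - ε) * (1 + s) + (2 + 4 * K)) := by field_simp; ring
    have e2 : ((1 - ε) / (1 + s) - 2 * ε) * (1 + s) = (1 - ε) - 2 * ε * (1 + s) := by field_simp
    rwa [e1, e2] at this
  have hB : 0 ≤ δ * ((4 + C + 8 * K + (1 - ε)) * (1 + s)) := by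
    have : 0 ≤ 1 - ε := by linarith
    positivity
  have hεs : 0 < ε * (1 + s) := by positivity
  have hKδ : 0 ≤ K * δ := by positivity
  have hE : ε + 2 * δ * (1 + 2 * K) < 1 := by nlinarith
  refine ⟨hE, ?_, ?_⟩
  · nlinarith
  · have hE1 : 0 < 1 - (ε + 2 * δ * (1 + 2 * K)) := by linarith
    have e3 : (1 + s) * (2 * (ε + 2 * δ * (1 + 2 * K)) / (1 - (ε + 2 * δ * (1 + 2 * K))) +
        (1 + C / (1 - (ε + 2 * δ * (1 + 2 * K)))) * δ) =
        ((1 + s) * (2 * (ε + 2 * δ * (1 + 2 * K)) +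
          (1 - (ε + 2 * δ * (1 + 2 * K)) + C) * δ)) / (1 - (ε + 2 * δ * (1 + 2 * K))) := by
      field_simp
    rw [e3, div_lt_one hE1]
    have hsq : 0 ≤ (1 + s) * (2 * δ * (1 + 2 * K) * δ) := by positivity
    nlinarith

end Scalar

/-- The restricted isometry property is stable under a perturbation of the projection. -/
lemma norm_rip_perturb_le {E : Type*} [NormedAddCommGroup E] [NormedSpace ℝ E] {P Q R : E →L[ℝ] E}
    {ρ ε C η : ℝ} (hρ : 0 ≤ ρ) (hP : ‖P‖ ≤ 1) (hQ : ‖Q‖ ≤ 1) (hR : ‖R‖ ≤ C) (hPQ : ‖Q - P‖ ≤ η)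
    (h : ‖P - ρ • (P ∘L R ∘L P)‖ ≤ ε) :
    ‖Q - ρ • (Q ∘L R ∘L Q)‖ ≤ ε + η * (1 + 2 * (C * ρ)) := by
  have hC : 0 ≤ C := (norm_nonneg _).trans hR
  have hη : 0 ≤ η := (norm_nonneg _).trans hPQ
  have hsplit : Q - ρ • (Q ∘L R ∘L Q) = (P - ρ • (P ∘L R ∘L P)) + (Q - P) -
      ρ • ((Q - P) ∘L (R ∘L Q) + P ∘L (R ∘L (Q - P))) := by
    ext x
    simp only [sub_apply, add_apply, smul_apply, ContinuousLinearMap.comp_apply, map_sub, smul_sub,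
      smul_add]
    abel
  have hcomp : ∀ S T : E →L[ℝ] E, ‖S ∘L T‖ ≤ ‖S‖ * ‖T‖ := fun S T => S.opNorm_comp_le T
  have h1 : ‖(Q - P) ∘L (R ∘L Q)‖ ≤ η * (C * 1) :=
    (hcomp _ _).trans (mul_le_mul hPQ ((hcomp _ _).trans (by gcongr)) (norm_nonneg _) hη)
  have h2 : ‖P ∘L (R ∘L (Q - P))‖ ≤ 1 * (C * η) :=
    (hcomp _ _).trans (mul_le_mul hP ((hcomp _ _).trans (by gcongr)) (norm_nonneg _) zero_le_one)
  rw [hsplit]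
  calc _ ≤ (‖P - ρ • (P ∘L R ∘L P)‖ + ‖Q - P‖) +
        ρ * (‖(Q - P) ∘L (R ∘L Q)‖ + ‖P ∘L (R ∘L (Q - P))‖) := by
        refine (norm_sub_le _ _).trans (add_le_add (norm_add_le _ _) ?_)
        rw [norm_smul, Real.norm_of_nonneg hρ]
        gcongr
        exact norm_add_le _ _
    _ ≤ (ε + η) + ρ * (η * (C * 1) + 1 * (C * η)) := by gcongr
    _ = _ := by ring

/-! ### One descent step and its iteration. -/

section Convergence

variable {d : ℕ} {n : Fin d → ℕ} {r : Fin (d - 1) → ℕ} {A X X' : Tensor n}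
  {Ω : Multiset (MultiIndex n)} {ε C : ℝ}

lemma density_nonneg (Ω : Multiset (MultiIndex n)) : 0 ≤ density Ω := by
  unfold density
  positivity

lemma sigmaMin_nonneg (X : Tensor n) : 0 ≤ sigmaMin X := by
  refine inv_nonneg.2 (Finset.sum_nonneg fun k _ => one_div_nonneg.2 (Real.sInf_nonneg ?_))
  exact fun s hs => hs.1.le

lemma sigmaMin_pos (hd : 2 ≤ d) (hX : X ≠ 0) : 0 < sigmaMin X := by
  have : Nonempty (Fin (d - 1)) := ⟨⟨0, by omega⟩⟩
  exact inv_pos.2 (Finset.sum_pos (fun k _ => one_div_pos.2 (hasGap_unfolding hX _).1)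
    Finset.univ_nonempty)

lemma tangentProj_self (hA : A ∈ fixedRank n r) (hA0 : A ≠ 0) : tangentProj r A A = A :=
  Submodule.starProjection_eq_self_iff.2 (self_mem_tangentSpaceAt hA hA0)

/-- For zero density the inverse is 0 by convention, and the hypothesis would read ‖P_A‖ < ε < 1,
although P_A fixes A ≠ 0. -/
lemma density_pos (hA : A ∈ fixedRank n r) (hA0 : A ≠ 0)
    (hRIP : ‖tangentProj r A - (density Ω)⁻¹ •
      (tangentProj r A ∘L samplingOp Ω ∘L tangentProj r A)‖ < ε) (hε : ε < 1) : 0 < density Ω := by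
  refine (density_nonneg Ω).lt_of_ne' fun h0 => ?_
  have hz : (0 : ℝ) • (tangentProj r A ∘L samplingOp Ω ∘L tangentProj r A) = 0 :=
    ContinuousLinearMap.ext fun x => zero_smul ℝ _
  rw [h0, inv_zero, hz, sub_zero] at hRIP
  have h1 := (tangentProj r A).le_opNorm A
  rw [tangentProj_self hA hA0] at h1
  have : 0 < ‖A‖ := norm_pos_iff.2 hA0
  nlinarith

lemma IsRGDStep.eq_of_self (hd : 2 ≤ d) (hA : A ∈ fixedRank n r) (h : IsRGDStep r Ω A A X') :
    X' = A := by
  have h1 := IsTTSVD.norm_sub_le hd h hA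
  simp only [riemGrad, sub_self, map_zero, smul_zero, sub_zero, norm_zero, mul_zero] at h1
  exact sub_eq_zero.1 (norm_le_zero_iff.1 h1)

lemma epsAt_eq (Ω : Multiset (MultiIndex n)) (ε C : ℝ) (A X : Tensor n) :
    epsAt Ω ε C A X = ε + 2 * (‖X - A‖ / sigmaMin A) * (1 + 2 * (C * (density Ω)⁻¹)) := by
  rw [epsAt]
  ring

/-- One step of Riemannian gradient descent. -/
lemma IsRGDStep.norm_sub_lt (hd : 2 ≤ d) (hA : A ∈ fixedRank n r) (hX : X ∈ fixedRank n r)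
    (hXA : X ≠ A)
    (hRIP : ‖tangentProj r A - (density Ω)⁻¹ •
      (tangentProj r A ∘L samplingOp Ω ∘L tangentProj r A)‖ < ε)
    (hC : ‖samplingOp Ω‖ ≤ C) (hε : epsAt Ω ε C A X < 1) (h : IsRGDStep r Ω A X X') :
    ‖X' - A‖ < betaAt Ω ε C A X * ‖X - A‖ := by
  have hA0 : A ≠ 0 := by
    rintro rfl
    exact ne_zero_of_mem_fixedRank hd hX hA hXA rfl
  have hX0 : X ≠ 0 := ne_zero_of_mem_fixedRank hd hA hX hA0
  have hε0 : 0 < ε := (norm_nonneg _).trans_lt hRIP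
  have hC0 : 0 ≤ C := (norm_nonneg _).trans hC
  have hD : 0 < ‖X - A‖ := norm_pos_iff.2 (sub_ne_zero.2 hXA)
  have hδ : 0 < ‖X - A‖ / sigmaMin A := div_pos hD (sigmaMin_pos hd hA0)
  rw [betaAt, epsAt_eq] at *
  set δ := ‖X - A‖ / sigmaMin A with hδdef
  have hρ' : 0 ≤ (density Ω)⁻¹ := inv_nonneg.2 (density_nonneg Ω)
  have hK : 0 ≤ C * (density Ω)⁻¹ := mul_nonneg hC0 hρ'
  have hε1 : ε < 1 := by nlinarith [mul_nonneg hδ.le hK]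
  have hρ : 0 < (density Ω)⁻¹ := inv_pos.2 (density_pos hA hA0 hRIP hε1)
  have hlt := contraction_lt hε0.le hδ hC0 hK hε
  set K := C * (density Ω)⁻¹
  have hrip : ‖tangentProj r X - (density Ω)⁻¹ •
      (tangentProj r X ∘L samplingOp Ω ∘L tangentProj r X)‖ ≤ ε + 3 / 2 * δ * (1 + 2 * K) := by
    refine norm_rip_perturb_le hρ' (Submodule.starProjection_norm_le _)
      (Submodule.starProjection_norm_le _) hC ?_ hRIP.le
    refine (norm_tangentProj_sub_le hA hX hA0 hX0).trans ?_
    -- Any constant between √2 and 2 works here if it leaves enough slack for `contraction_lt`; 3/2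
    -- does.
    have : √2 ≤ 3 / 2 := Real.sqrt_le_iff.2 ⟨by norm_num, by norm_num⟩
    gcongr
  have he : ε + 3 / 2 * δ * (1 + 2 * K) < 1 := by nlinarith [mul_nonneg hδ.le hK]
  have he0 : 0 < 1 - (ε + 3 / 2 * δ * (1 + 2 * K)) := by linarith
  have hstep := norm_sub_lineSearch_le (tangentSpaceAt (fixedRank n r) X) (samplingOp Ω) hρ
    (by positivity) he hC hrip (X - A)
  have hcurv := norm_sub_tangentProj_self_le hX hA0 hX0
  have hs : 0 < 1 + √((d : ℝ) - 1) := by positivity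
  refine (IsTTSVD.norm_sub_le hd h hA).trans_lt ?_
  rw [mul_assoc]
  refine mul_lt_mul_of_pos_left ?_ hs
  have heq : X - stepSize Ω (riemGrad r Ω A X) • riemGrad r Ω A X - A =
      (X - A) - stepSize Ω (riemGrad r Ω A X) • riemGrad r Ω A X := by abel
  rw [heq]
  have hgrad : riemGrad r Ω A X =
      (tangentSpaceAt (fixedRank n r) X).starProjection (samplingOp Ω (X - A)) := by
    rw [riemGrad, ← map_sub]
    rfl
  rw [stepSize, hgrad]
  refine hstep.trans_lt ?_
  have hκ : 0 ≤ 1 + (density Ω)⁻¹ * C / (1 - (ε + 3 / 2 * δ * (1 + 2 * K))) := by positivity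
  calc _ ≤ 2 * (ε + 3 / 2 * δ * (1 + 2 * K)) / (1 - (ε + 3 / 2 * δ * (1 + 2 * K))) * ‖X - A‖ +
        (1 + (density Ω)⁻¹ * C / (1 - (ε + 3 / 2 * δ * (1 + 2 * K)))) * (δ * ‖X - A‖) := by
        gcongr
        exact hcurv
    _ = (2 * (ε + 3 / 2 * δ * (1 + 2 * K)) / (1 - (ε + 3 / 2 * δ * (1 + 2 * K))) +
        (1 + K / (1 - (ε + 3 / 2 * δ * (1 + 2 * K)))) * δ) * ‖X - A‖ := by
        rw [mul_comm (density Ω)⁻¹ C]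
        ring
    _ < _ := mul_lt_mul_of_pos_right hlt hD

/-- A result of the TT-SVD that is close to `A` has the TT-rank of `A`. -/
lemma IsTTSVD.mem_fixedRank {Z : Tensor n} (hA : A ∈ fixedRank n r) (hA0 : A ≠ 0)
    (h : IsTTSVD r Z X) (hX : ‖X - A‖ / sigmaMin A < 1) : X ∈ fixedRank n r := by
  funext k
  refine le_antisymm (h.rank_le k) ?_
  rw [← rank_unfolding hA k]
  have hg := hasGap_unfolding hA0 (k + 1)
  refine hg.rank_matricize_le ((div_lt_one hg.1).1 (lt_of_le_of_lt ?_ hX))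
  rw [div_sigmaMin]
  exact Finset.single_le_sum
    (f := fun k : Fin (d - 1) => ‖X - A‖ / sigmaMinMatrix (unfolding (k + 1) A))
    (fun k _ => div_nonneg (norm_nonneg _) (hasGap_unfolding hA0 _).1.le) (Finset.mem_univ k)

lemma betaAt_mono (hε : 0 ≤ ε) (hC : 0 ≤ C) (hXX' : ‖X' - A‖ ≤ ‖X - A‖)
    (h : epsAt Ω ε C A X < 1) :
    epsAt Ω ε C A X' < 1 ∧ betaAt Ω ε C A X' ≤ betaAt Ω ε C A X := by
  have hK : 0 ≤ C * (density Ω)⁻¹ := mul_nonneg hC (inv_nonneg.2 (density_nonneg Ω))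
  have hσ := sigmaMin_nonneg A
  have hδ : ‖X' - A‖ / sigmaMin A ≤ ‖X - A‖ / sigmaMin A := by gcongr
  simp only [betaAt, epsAt_eq] at *
  refine ⟨lt_of_le_of_lt (by gcongr) h, ?_⟩
  exact contraction_mono hε (by positivity) hδ hC hK (Real.sqrt_nonneg _) h

lemma betaAt_pos (hε : 0 < ε) (hC : 0 ≤ C) (h : epsAt Ω ε C A X < 1) :
    0 < betaAt Ω ε C A X := by
  have hK : 0 ≤ C * (density Ω)⁻¹ := mul_nonneg hC (inv_nonneg.2 (density_nonneg Ω))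
  have hσ := sigmaMin_nonneg A
  have hE : 0 < epsAt Ω ε C A X := by rw [epsAt_eq]; positivity
  have : 0 < 1 - epsAt Ω ε C A X := by linarith
  unfold betaAt
  positivity

end Convergence

end TTCompletion

end

theorem mainTheorem1 {d : ℕ} (hd : 2 ≤ d) (n : Fin d → ℕ) (r : Fin (d - 1) → ℕ)
    (A : TTCompletion.Tensor n) (hA : A ∈ TTCompletion.fixedRank n r)
    (Ω : Multiset (TTCompletion.MultiIndex n)) (ε C : ℝ)
    (hRIP : ‖TTCompletion.tangentProj r A - (TTCompletion.density Ω)⁻¹ •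
      (TTCompletion.tangentProj r A ∘L TTCompletion.samplingOp Ω ∘L
        TTCompletion.tangentProj r A)‖ < ε)
    (hC : ‖TTCompletion.samplingOp Ω‖ ≤ C)
    (X : ℕ → TTCompletion.Tensor n)
    (hX : ∀ t, TTCompletion.IsRGDStep r Ω A (X t) (X (t + 1))) :
    (∀ t, X t ∈ TTCompletion.fixedRank n r → TTCompletion.epsAt Ω ε C A (X t) < 1 →
      ‖X (t + 1) - A‖ ≤ TTCompletion.betaAt Ω ε C A (X t) * ‖X t - A‖) ∧
    (ε < (3 + 2 * √((d : ℝ) - 1))⁻¹ →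
      X 0 ∈ TTCompletion.fixedRank n r →
      ‖X 0 - A‖ / TTCompletion.sigmaMin A <
        (5 + C + 8 * C * (TTCompletion.density Ω)⁻¹ +
            (2 + 4 * C * (TTCompletion.density Ω)⁻¹) / (1 + √((d : ℝ) - 1)) - ε)⁻¹ *
          ((1 - ε) / (1 + √((d : ℝ) - 1)) - 2 * ε) →
      TTCompletion.betaAt Ω ε C A (X 0) < 1 ∧
      ∀ t, ‖X (t + 1) - A‖ ≤ TTCompletion.betaAt Ω ε C A (X 0) ^ (t + 1) * ‖X 0 - A‖ ∧
        (X 0 ≠ A →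
          ‖X (t + 1) - A‖ < TTCompletion.betaAt Ω ε C A (X 0) ^ (t + 1) * ‖X 0 - A‖)) := by
  have hε0 : 0 < ε := (norm_nonneg _).trans_lt hRIP
  have hC0 : 0 ≤ C := (norm_nonneg _).trans hC
  have hself : ∀ t, X t = A → X (t + 1) = A := fun t ht =>
    TTCompletion.IsRGDStep.eq_of_self hd hA (ht ▸ hX t)
  have hK : 0 ≤ C * (TTCompletion.density Ω)⁻¹ :=
    mul_nonneg hC0 (inv_nonneg.2 (TTCompletion.density_nonneg Ω))
  refine ⟨fun t ht hεt => ?_, fun hε hX0 hclose => ?_⟩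
  · rcases eq_or_ne (X t) A with h | h
    · simp [hself t h, h]
    · exact (TTCompletion.IsRGDStep.norm_sub_lt hd hA ht h hRIP hC hεt (hX t)).le
  have hs : 1 ≤ √((d : ℝ) - 1) := by
    rw [Real.one_le_sqrt]
    have : (2 : ℝ) ≤ d := by exact_mod_cast hd
    linarith
  obtain ⟨hE, hδ1, hβ⟩ := TTCompletion.contraction_lt_one hε0
    (div_nonneg (norm_nonneg _) (TTCompletion.sigmaMin_nonneg A)) hC0 hK hs hε
    (by simpa only [mul_assoc] using hclose)
  rw [← TTCompletion.epsAt_eq] at hE hβ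
  change TTCompletion.betaAt Ω ε C A (X 0) < 1 at hβ
  set β := TTCompletion.betaAt Ω ε C A (X 0) with hβdef
  have hβ0 : 0 < β := TTCompletion.betaAt_pos hε0 hC0 hE
  refine ⟨hβ, ?_⟩
  -- The stationary case is separate: it includes A = 0, where σ_min(A) degenerates to 0, and
  -- strictness fails there.
  rcases eq_or_ne (X 0) A with h0 | h0
  · have hall : ∀ t, X t = A := fun t => by
      induction t with
      | zero => exact h0
      | succ t ih => exact hself t ih
    exact fun t => ⟨by simp [hall], fun h => absurd h0 h⟩
  have hA0 : A ≠ 0 := by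
    rintro rfl
    exact TTCompletion.ne_zero_of_mem_fixedRank hd hX0 hA h0 rfl
  have hD : 0 < ‖X 0 - A‖ := norm_pos_iff.2 (sub_ne_zero.2 h0)
  have hσ := TTCompletion.sigmaMin_nonneg A
  have hstep : ∀ t, X t ∈ TTCompletion.fixedRank n r → ‖X t - A‖ ≤ β ^ t * ‖X 0 - A‖ →
      ‖X (t + 1) - A‖ < β ^ (t + 1) * ‖X 0 - A‖ := by
    intro t ht hle
    rcases eq_or_ne (X t) A with h | h
    · rw [hself t h, sub_self, norm_zero]
      positivity
    have hle0 : ‖X t - A‖ ≤ ‖X 0 - A‖ :=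
      hle.trans (mul_le_of_le_one_left hD.le (pow_le_one₀ hβ0.le hβ.le))
    obtain ⟨hεt, hβt⟩ := TTCompletion.betaAt_mono hε0.le hC0 hle0 hE
    calc ‖X (t + 1) - A‖ < TTCompletion.betaAt Ω ε C A (X t) * ‖X t - A‖ :=
          TTCompletion.IsRGDStep.norm_sub_lt hd hA ht h hRIP hC hεt (hX t)
      _ ≤ β * (β ^ t * ‖X 0 - A‖) := by gcongr
      _ = _ := by ring
  -- The two invariants need each other: the step bound requires the rank, and the rank of the next
  -- iterate follows from its closeness to A.
  have hinv : ∀ t, X t ∈ TTCompletion.fixedRank n r ∧ ‖X t - A‖ ≤ β ^ t * ‖X 0 - A‖ := by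
    intro t
    induction t with
    | zero => exact ⟨hX0, by simp⟩
    | succ t ih =>
      have hlt := (hstep t ih.1 ih.2).le
      refine ⟨TTCompletion.IsTTSVD.mem_fixedRank hA hA0 (hX t) (lt_of_le_of_lt ?_ hδ1), hlt⟩
      gcongr
      exact hlt.trans (mul_le_of_le_one_left hD.le (pow_le_one₀ hβ0.le hβ.le))
  exact fun t => ⟨(hstep t (hinv t).1 (hinv t).2).le, fun _ => hstep t (hinv t).1 (hinv t).2⟩
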